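/- Let $M$ be a smooth ($C^\infty$, Hausdorff, finite-dimensional, without boundary) real manifold. A generalized complex structure on $M$ is a smooth bundle map $\mathcal J$ of $TM\oplus T^*M$ over the identity with $\mathcal J^2=-\mathrm{Id}$ and $$[\mathcal J\alpha,\mathcal J\beta]-[\alpha,\beta]-\mathcal J\big([\mathcal J\alpha,\beta]+[\alpha,\mathcal J\beta]\big)=0$$ for all smooth sections $\alpha,\beta$ of $TM\oplus T^*M$, where $$[(X,\xi),(Y,\eta)]=\big([X,Y],\,L_X\eta-L_Y\xi-\tfrac12 d(i_X\eta-i_Y\xi)\big)$$ is the Courant bracket. Let $\pi^\sharp:T^*M\to TM$ be the corresponding component of $\mathcal J$; $\mathcal J$ is called non-degenerate if $\pi^\sharp$ is an isomorphism at every point. A Hitchin pair on $M$ is a pair $(\omega,a)$ consisting of a symplectic form $\omega$ and a $(1,1)$-tensor $a:TM\to TM$ such that $\omega(aX,Y)=\omega(X,aY)$ for all $X,Y$ and such that the 2-form $\omega_a(X,Y)=\omega(aX,Y)$ is closed. Its twist is the 2-form $\sigma=-(\omega+a^*\omega)$, where $(a^*\omega)(X,Y)=\omega(aX,aY)$. For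 a 2-form $\theta$ write $\theta_\sharp X=i_X\theta$. Proposition. There is a one-to-one correspondence between the non-degenerate generalized complex structures $\mathcal J$ on $M$ and the Hitchin pairs $(\omega,a)$ on $M$, such that for corresponding $\mathcal J$ and $(\omega,a)$ $$\mathcal J=\begin{pmatrix} a & \pi^\sharp\\ \sigma_\sharp & -a^*\end{pmatrix},$$ where $\pi(\xi,\eta)=\eta(\pi^\sharp\xi)$ is a bivector (that is, it is antisymmetric), $\pi^\sharp$ is the inverse of $\omega_\sharp$, $\sigma$ is the twist of $(\omega,a)$, and $a^*\xi=\xi\circ a$. -/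

import Mathlib

open Bundle
open scoped Manifold ContDiff Bundle

noncomputable section

namespace GenComplex

section Defs

variable {E : Type*} [NormedAddCommGroup E] [NormedSpace ℝ E]
  {M : Type*} [TopologicalSpace M] [ChartedSpace E M]

variable (E) in
/-- The cotangent space `T*ₓM`. -/
abbrev CotangentSpace (x : M) : Type _ := TangentSpace 𝓘(ℝ, E) x →L[ℝ] ℝ

variable (E) in
/-- The fibre at `x` of the generalized tangent bundle `TM ⊕ T*M`. -/
abbrev GenTangentSpace (x : M) : Type _ := TangentSpace 𝓘(ℝ, E) x × CotangentSpace E x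

/-! ### The exterior derivative, the Lie derivative and the Courant bracket -/

/-- The expression of a differential `k`-form on `M` in the preferred chart at `x₀`: the pullback of
the form by the inverse of the chart. -/
def formInChart {k : ℕ} (η : Π x : M, TangentSpace 𝓘(ℝ, E) x [⋀^Fin k]→L[ℝ] ℝ) (x₀ : M) :
    E → E [⋀^Fin k]→L[ℝ] ℝ :=
  fun y ↦ (η ((extChartAt 𝓘(ℝ, E) x₀).symm y)).compContinuousLinearMap
    (mfderiv 𝓘(ℝ, E) 𝓘(ℝ, E) (extChartAt 𝓘(ℝ, E) x₀).symm y)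

/-- The exterior derivative of a differential `k`-form on `M`: at `x₀` it is the pullback by the
chart at `x₀` of the exterior derivative of the expression of the form in that chart. -/
def mextDeriv {k : ℕ} (η : Π x : M, TangentSpace 𝓘(ℝ, E) x [⋀^Fin k]→L[ℝ] ℝ) (x₀ : M) :
    TangentSpace 𝓘(ℝ, E) x₀ [⋀^Fin (k + 1)]→L[ℝ] ℝ :=
  ContinuousAlternatingMap.compContinuousLinearMap
    (extDeriv (formInChart η x₀) (extChartAt 𝓘(ℝ, E) x₀ x₀))
    (mfderiv 𝓘(ℝ, E) 𝓘(ℝ, E) (extChartAt 𝓘(ℝ, E) x₀) x₀)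

/-- The differential `df` of a real function, as a 1-form. -/
def dFun (f : M → ℝ) (x : M) : CotangentSpace E x :=
  mfderiv 𝓘(ℝ, E) 𝓘(ℝ, ℝ) f x

/-- The exterior derivative of a 1-form. -/
def dOne (η : Π x : M, CotangentSpace E x) (x : M) :
    TangentSpace 𝓘(ℝ, E) x [⋀^Fin 2]→L[ℝ] ℝ :=
  mextDeriv (fun y ↦ ContinuousAlternatingMap.ofSubsingleton ℝ (TangentSpace 𝓘(ℝ, E) y) ℝ
    (0 : Fin 1) (η y)) x

/-- The contraction `i_u θ = θ(u, ·)` of a 2-covector with a tangent vector. -/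
def contract {x : M} (u : TangentSpace 𝓘(ℝ, E) x)
    (θ : TangentSpace 𝓘(ℝ, E) x [⋀^Fin 2]→L[ℝ] ℝ) : CotangentSpace E x :=
  θ.toContinuousMultilinearMap.toContinuousLinearMap ![u, 0] 1

lemma contract_apply {x : M} (u v : TangentSpace 𝓘(ℝ, E) x)
    (θ : TangentSpace 𝓘(ℝ, E) x [⋀^Fin 2]→L[ℝ] ℝ) : contract u θ v = θ ![u, v] := by
  have h : Function.update ![u, 0] 1 v = ![u, v] := by
    ext i; fin_cases i <;> simp
  simp [contract, h]

/-- The Lie derivative of a 1-form along a vector field, `L_X η = i_X dη + d(η(X))`. -/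
def lieOne (X : Π x : M, TangentSpace 𝓘(ℝ, E) x) (η : Π x : M, CotangentSpace E x) (x : M) :
    CotangentSpace E x :=
  contract (X x) (dOne η x) + dFun (fun y ↦ η y (X y)) x

/-- The Courant bracket of sections of `TM ⊕ T*M`,
`[(X, ξ), (Y, η)] = ([X, Y], L_X η - L_Y ξ - ½ d(η(X) - ξ(Y)))`. -/
def courantBracket (α β : Π x : M, GenTangentSpace E x) (x : M) : GenTangentSpace E x :=
  (VectorField.mlieBracket 𝓘(ℝ, E) (fun y ↦ (α y).1) (fun y ↦ (β y).1) x,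
    lieOne (fun y ↦ (α y).1) (fun y ↦ (β y).2) x
      - lieOne (fun y ↦ (β y).1) (fun y ↦ (α y).2) x
      - (1 / 2 : ℝ) • dFun (fun y ↦ (β y).2 (α y).1 - (α y).2 (β y).1) x)

/-- The alternating map attached to a bilinear form which vanishes on the diagonal. -/
def altOfBilin {x : M}
    (B : TangentSpace 𝓘(ℝ, E) x →L[ℝ] TangentSpace 𝓘(ℝ, E) x →L[ℝ] ℝ) (hB : ∀ v, B v v = 0) :
    TangentSpace 𝓘(ℝ, E) x [⋀^Fin 2]→L[ℝ] ℝ where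
  toFun v := B (v 0) (v 1)
  map_update_add' v i a b := by
    fin_cases i <;> simp [Function.update]
  map_update_smul' v i c a := by
    fin_cases i <;> simp [Function.update]
  map_eq_zero_of_eq' v i j hij hne := by
    fin_cases i <;> fin_cases j <;> simp_all
  cont := by
    have h : Continuous fun p : E × E ↦ (show E →L[ℝ] E →L[ℝ] ℝ from B) p.1 p.2 :=
      (show E →L[ℝ] E →L[ℝ] ℝ from B).continuous₂
    have h' : Continuous fun v : Fin 2 → E ↦ (v 0, v 1) :=
      (continuous_apply 0).prodMk (continuous_apply 1)
    exact h.comp h'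

/-! ### Smooth tensors -/

/-- A (smooth) section of `TM ⊕ T*M`. -/
def IsSmoothSection [IsManifold 𝓘(ℝ, E) ∞ M] (α : Π x : M, GenTangentSpace E x) : Prop :=
  ContMDiff 𝓘(ℝ, E) (𝓘(ℝ, E).prod 𝓘(ℝ, E × (E →L[ℝ] ℝ))) ∞
    (fun x ↦ TotalSpace.mk' (E × (E →L[ℝ] ℝ)) (E := fun y : M ↦ GenTangentSpace E y) x (α x))

variable (E M) in
/-- A (smooth) `(1, 1)`-tensor, that is, a smooth bundle map `a : TM → TM` over the identity. -/
@[ext]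
structure EndField [IsManifold 𝓘(ℝ, E) ∞ M] where
  toFun : Π x : M, TangentSpace 𝓘(ℝ, E) x →L[ℝ] TangentSpace 𝓘(ℝ, E) x
  smooth : ContMDiff 𝓘(ℝ, E) (𝓘(ℝ, E).prod 𝓘(ℝ, E →L[ℝ] E)) ∞
    (fun x ↦ TotalSpace.mk' (E →L[ℝ] E) (E := fun y : M ↦
      (TangentSpace 𝓘(ℝ, E) y →L[ℝ] TangentSpace 𝓘(ℝ, E) y)) x (toFun x))

variable (E M) in
/-- A (smooth) differential 2-form `ω` on `M`, given by the bundle map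
`ω_♯ : TM → T*M`, `ω_♯ X = i_X ω = ω(X, ·)`. -/
@[ext]
structure TwoForm [IsManifold 𝓘(ℝ, E) ∞ M] where
  toFun : Π x : M, TangentSpace 𝓘(ℝ, E) x →L[ℝ] CotangentSpace E x
  smooth : ContMDiff 𝓘(ℝ, E) (𝓘(ℝ, E).prod 𝓘(ℝ, E →L[ℝ] E →L[ℝ] ℝ)) ∞
    (fun x ↦ TotalSpace.mk' (E →L[ℝ] E →L[ℝ] ℝ) (E := fun y : M ↦
      (TangentSpace 𝓘(ℝ, E) y →L[ℝ] CotangentSpace E y)) x (toFun x))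
  alternating : ∀ x v, toFun x v v = 0

variable [IsManifold 𝓘(ℝ, E) ∞ M]

/-- Composition of smooth bundle maps `TM → TM → T*M` is smooth. -/
lemma contMDiff_comp_endField
    {B : Π x : M, TangentSpace 𝓘(ℝ, E) x →L[ℝ] CotangentSpace E x}
    (hB : ContMDiff 𝓘(ℝ, E) (𝓘(ℝ, E).prod 𝓘(ℝ, E →L[ℝ] E →L[ℝ] ℝ)) ∞
      (fun x ↦ TotalSpace.mk' (E →L[ℝ] E →L[ℝ] ℝ) (E := fun y : M ↦
        (TangentSpace 𝓘(ℝ, E) y →L[ℝ] CotangentSpace E y)) x (B x)))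
    (a : EndField E M) :
    ContMDiff 𝓘(ℝ, E) (𝓘(ℝ, E).prod 𝓘(ℝ, E →L[ℝ] E →L[ℝ] ℝ)) ∞
      (fun x ↦ TotalSpace.mk' (E →L[ℝ] E →L[ℝ] ℝ) (E := fun y : M ↦
        (TangentSpace 𝓘(ℝ, E) y →L[ℝ] CotangentSpace E y)) x ((B x).comp (a.toFun x))) := by
  intro x₀
  have h1 := hB x₀
  have h2 := a.smooth x₀
  rw [contMDiffAt_hom_bundle] at h1 h2 ⊢
  refine ⟨h1.1, (h1.2.clm_comp h2.2).congr_of_eventuallyEq ?_⟩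
  have hs := (trivializationAt E (TangentSpace 𝓘(ℝ, E) : M → Type _) x₀).open_baseSet.mem_nhds
    (FiberBundle.mem_baseSet_trivializationAt' x₀)
  filter_upwards [hs] with x hx
  ext1 v
  simp only [ContinuousLinearMap.inCoordinates, ContinuousLinearMap.comp_apply]
  congr 2
  exact (Trivialization.symmL_continuousLinearMapAt _ hx _).symm


namespace TwoForm

/-- The 2-form `ω` as a field of alternating maps. -/
def toAlt (omega : TwoForm E M) (x : M) : TangentSpace 𝓘(ℝ, E) x [⋀^Fin 2]→L[ℝ] ℝ :=
  altOfBilin (omega.toFun x) (omega.alternating x)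

/-- `dω = 0`. -/
def IsClosed (omega : TwoForm E M) : Prop := ∀ x, mextDeriv omega.toAlt x = 0

/-- `ω` is non-degenerate. -/
def IsNondegenerate (omega : TwoForm E M) : Prop :=
  ∀ x u, (∀ v, omega.toFun x u v = 0) → u = 0

/-- A symplectic form is a closed non-degenerate 2-form. -/
def IsSymplectic (omega : TwoForm E M) : Prop := omega.IsClosed ∧ omega.IsNondegenerate

lemma swap (omega : TwoForm E M) (x : M) (u v : TangentSpace 𝓘(ℝ, E) x) :
    omega.toFun x u v = -omega.toFun x v u := by
  have h := omega.alternating x (u + v)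
  simp only [map_add, add_apply, omega.alternating, zero_add, add_zero] at h
  linarith

/-- `ω` and `a` commute: `ω(aX, Y) = ω(X, aY)`. -/
def Commutes (omega : TwoForm E M) (a : EndField E M) : Prop :=
  ∀ x u v, omega.toFun x (a.toFun x u) v = omega.toFun x u (a.toFun x v)

/-- The 2-form `ω_a(X, Y) = ω(aX, Y)`, where `ω` and `a` commute. -/
def compEnd (omega : TwoForm E M) (a : EndField E M) (h : omega.Commutes a) : TwoForm E M where
  toFun x := (omega.toFun x).comp (a.toFun x)
  smooth := contMDiff_comp_endField omega.smooth a
  alternating x v := by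
    have h1 := h x v v
    have h2 := omega.swap x (a.toFun x v) v
    simp only [ContinuousLinearMap.comp_apply]
    linarith

end TwoForm

variable (E M) in
/-- A Hitchin pair: a symplectic form `ω` and a `(1, 1)`-tensor `a` which commutes with `ω` and
such that `ω_a` is closed. -/
@[ext]
structure HitchinPair where
  omega : TwoForm E M
  a : EndField E M
  symplectic : omega.IsSymplectic
  commutes : omega.Commutes a
  closed : (omega.compEnd a commutes).IsClosed

namespace HitchinPair

/-- The bilinear form `(a*ω)(X, Y) = ω(aX, aY)`. -/
def pullback (p : HitchinPair E M) (x : M) : TangentSpace 𝓘(ℝ, E) x →L[ℝ] CotangentSpace E x :=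
  (ContinuousLinearMap.precomp ℝ (p.a.toFun x)).comp ((p.omega.toFun x).comp (p.a.toFun x))

lemma pullback_apply (p : HitchinPair E M) (x : M) (u v : TangentSpace 𝓘(ℝ, E) x) :
    p.pullback x u v = p.omega.toFun x (p.a.toFun x u) (p.a.toFun x v) := rfl

lemma pullback_eq (p : HitchinPair E M) (x : M) :
    p.pullback x = ((p.omega.toFun x).comp (p.a.toFun x)).comp (p.a.toFun x) := by
  ext u v
  exact (p.commutes x (p.a.toFun x u) v).symm

/-- The twist `σ = -(ω + a*ω)` of a Hitchin pair. -/
def twist (p : HitchinPair E M) : TwoForm E M where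
  toFun x := -(p.omega.toFun x + p.pullback x)
  smooth := by
    simp only [pullback_eq]
    exact (p.omega.smooth.add_section
      (contMDiff_comp_endField (contMDiff_comp_endField p.omega.smooth p.a) p.a)).neg_section
  alternating x v := by
    simp [pullback_apply, p.omega.alternating]

end HitchinPair

/-! ### Generalized complex structures -/

variable (E M) in
/-- A generalized complex structure: a smooth bundle map `J` of `TM ⊕ T*M` over the identity with
`J² = -Id` and with vanishing torsion for the Courant bracket. -/
@[ext]
structure GenComplexStructure where
  toFun : Π x : M, GenTangentSpace E x →L[ℝ] GenTangentSpace E x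
  smooth : ContMDiff 𝓘(ℝ, E) (𝓘(ℝ, E).prod 𝓘(ℝ, (E × (E →L[ℝ] ℝ)) →L[ℝ] (E × (E →L[ℝ] ℝ)))) ∞
    (fun x ↦ TotalSpace.mk' ((E × (E →L[ℝ] ℝ)) →L[ℝ] (E × (E →L[ℝ] ℝ))) (E := fun y : M ↦
      (GenTangentSpace E y →L[ℝ] GenTangentSpace E y)) x (toFun x))
  sq_eq_neg : ∀ x v, toFun x (toFun x v) = -v
  torsion_free : ∀ α β : Π x : M, GenTangentSpace E x, IsSmoothSection α → IsSmoothSection β →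
    ∀ x, courantBracket (fun y ↦ toFun y (α y)) (fun y ↦ toFun y (β y)) x - courantBracket α β x
      - toFun x (courantBracket (fun y ↦ toFun y (α y)) β x
        + courantBracket α (fun y ↦ toFun y (β y)) x) = 0

namespace GenComplexStructure

/-- The component `π♯ : T*M → TM` of a generalized complex structure. The bivector `π` itself is
`π(ξ, η) = η(π♯ ξ)`. -/
def piSharp (J : GenComplexStructure E M) (x : M) :
    CotangentSpace E x →L[ℝ] TangentSpace 𝓘(ℝ, E) x :=
  (ContinuousLinearMap.fst ℝ (TangentSpace 𝓘(ℝ, E) x) (CotangentSpace E x)).comp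
    ((J.toFun x).comp
      (ContinuousLinearMap.inr ℝ (TangentSpace 𝓘(ℝ, E) x) (CotangentSpace E x)))

/-- `π` is non-degenerate: `π♯` is an isomorphism at every point. -/
def IsNondegenerate (J : GenComplexStructure E M) : Prop :=
  ∀ x, Function.Bijective (J.piSharp x)

end GenComplexStructure

end Defs

end GenComplex

end

/-! Write `⟨(X, ξ), (Y, η)⟩ = η(X) + ξ(Y)` for the pairing on `TM ⊕ T*M`. The argument rests on four
facts about the torsion `N(α, β)` of an endomorphism `J` with `J² = -1`.

(1) `N` is not tensorial a priori, because the Courant bracket violates the Leibniz rule by a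
multiple of `(0, df)`. The defect of `N(α, fβ)` is `½(⟨α, β⟩ - ⟨Jα, Jβ⟩) df + ½(⟨Jα, β⟩ + ⟨α, Jβ⟩) J
df` (`torsion_smul_right`). If `N = 0` and `π♯` is injective, the vector component of this defect
forces `⟨Jα, β⟩ + ⟨α, Jβ⟩ = 0`, so `J` is skew (`IsNondegenerate.skew`). Hence `π` is a bivector and
the lower right block is `-a*`. With `ω_♯` the inverse of `π♯`, the equation `J² = -1` then gives
the commutation of `ω` with `a` and identifies the lower left block with the twist.

(2) The covectors are the `i_X ω`, and `J(0, i_X ω) = (X, -i_X ω_a)`. Since `[(X, 0), (0, i_Y B)] +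
[(0, i_X B), (Y, 0)] = (0, i_{[X,Y]} B + dB(X, Y, ·))`, the torsion on two covectors is `(-π♯(dω(X,
Y, ·)), dω(X, Y, a·) - dω_a(X, Y, ·))` (`torsion_contract`). So it vanishes exactly when `ω` and
`ω_a` are closed.

(3) `N(α, Jβ) = -J N(α, β)`, and `N` is additive and antisymmetric.

(4) Since `π♯` is onto, every section has the form `ζ + Jξ` with `ζ`, `ξ` covector fields
(`exists_eq_add`). With (3), vanishing on covectors implies vanishing everywhere.

Facts (1) and (2) give a Hitchin pair from `J`, and (2), (3), (4) give `J` from a Hitchin pair. The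
block form shows that the two constructions are mutually inverse. The analytic input is the
coordinate formula for the bracket in terms of 1-jets (`courantBracket_eq`), which turns the bracket
identities into algebra. -/

noncomputable section

set_option synthInstance.maxHeartbeats 400000

namespace GenComplex

/-! ### Smoothness of tensors in local trivializations. -/

section Trivializations

variable {E : Type*} [NormedAddCommGroup E] [NormedSpace ℝ E]
  {M : Type*} [TopologicalSpace M] [ChartedSpace E M] [IsManifold 𝓘(ℝ, E) ∞ M]

/-- The coordinates at `x` of the tangent vectors, in the trivialization at `x₀`. -/
def toCoord (x₀ x : M) : TangentSpace 𝓘(ℝ, E) x →L[ℝ] E :=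
  (trivializationAt E (TangentSpace 𝓘(ℝ, E) : M → Type _) x₀).continuousLinearMapAt ℝ x

/-- The tangent vectors at `x` with given coordinates in the trivialization at `x₀`. -/
def ofCoord (x₀ x : M) : E →L[ℝ] TangentSpace 𝓘(ℝ, E) x :=
  (trivializationAt E (TangentSpace 𝓘(ℝ, E) : M → Type _) x₀).symmL ℝ x

lemma toCoord_ofCoord {x₀ x : M} (hx : x ∈ (chartAt E x₀).source) (v : E) :
    toCoord x₀ x (ofCoord x₀ x v) = v :=
  Trivialization.continuousLinearMapAt_symmL _ hx v

lemma ofCoord_toCoord {x₀ x : M} (hx : x ∈ (chartAt E x₀).source) (v : TangentSpace 𝓘(ℝ, E) x) :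
    ofCoord x₀ x (toCoord x₀ x v) = v :=
  Trivialization.symmL_continuousLinearMapAt _ hx v

/-- The coordinates at `x` of the elements of `TM ⊕ T*M`, in the trivialization at `x₀`. -/
def toCoordGen (x₀ x : M) : GenTangentSpace E x →L[ℝ] E × (E →L[ℝ] ℝ) :=
  (toCoord x₀ x).prodMap (ContinuousLinearMap.precomp ℝ (ofCoord x₀ x))

/-- The element of `TM ⊕ T*M` at `x` with given coordinates in the trivialization at `x₀`. -/
def ofCoordGen (x₀ x : M) : E × (E →L[ℝ] ℝ) →L[ℝ] GenTangentSpace E x :=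
  (ofCoord x₀ x).prodMap (ContinuousLinearMap.precomp ℝ (toCoord x₀ x))

lemma toCoordGen_ofCoordGen {x₀ x : M} (hx : x ∈ (chartAt E x₀).source) (w : E × (E →L[ℝ] ℝ)) :
    toCoordGen x₀ x (ofCoordGen x₀ x w) = w := by
  refine Prod.ext (toCoord_ofCoord hx w.1) (ContinuousLinearMap.ext fun v ↦ ?_)
  exact congrArg w.2 (toCoord_ofCoord hx v)

lemma ofCoordGen_toCoordGen {x₀ x : M} (hx : x ∈ (chartAt E x₀).source) (w : GenTangentSpace E x) :
    ofCoordGen x₀ x (toCoordGen x₀ x w) = w := by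
  refine Prod.ext (ofCoord_toCoord hx w.1) (ContinuousLinearMap.ext fun v ↦ ?_)
  exact congrArg w.2 (ofCoord_toCoord hx v)

lemma trivializationAt_cotangent_apply {x₀ x : M} (ξ : CotangentSpace E x) :
    (trivializationAt (E →L[ℝ] ℝ) (fun y : M ↦ CotangentSpace E y) x₀ ⟨x, ξ⟩).2 =
      ContinuousLinearMap.precomp ℝ (ofCoord x₀ x) ξ := by
  rw [hom_trivializationAt_apply]
  ext v
  simp only [ContinuousLinearMap.inCoordinates, Bundle.Trivial.fiberBundle_trivializationAt',
    Bundle.Trivial.continuousLinearMapAt_trivialization]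
  rfl

lemma trivializationAt_genTangent_apply {x₀ x : M} (hx : x ∈ (chartAt E x₀).source)
    (w : GenTangentSpace E x) :
    (trivializationAt (E × (E →L[ℝ] ℝ)) (fun y : M ↦ GenTangentSpace E y) x₀ ⟨x, w⟩).2 =
      toCoordGen x₀ x w := by
  refine Prod.ext ?_ (trivializationAt_cotangent_apply w.2)
  change (trivializationAt E (TangentSpace 𝓘(ℝ, E) : M → Type _) x₀ ⟨x, w.1⟩).2 = toCoord x₀ x w.1
  rw [toCoord, Trivialization.continuousLinearMapAt_apply_of_mem]
  exact hx

lemma mem_baseSet_cotangent {x₀ x : M} (hx : x ∈ (chartAt E x₀).source) :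
    x ∈ (trivializationAt (E →L[ℝ] ℝ) (fun y : M ↦ CotangentSpace E y) x₀).baseSet :=
  ⟨hx, Set.mem_univ _⟩

lemma mem_baseSet_genTangent {x₀ x : M} (hx : x ∈ (chartAt E x₀).source) :
    x ∈ (trivializationAt (E × (E →L[ℝ] ℝ)) (fun y : M ↦ GenTangentSpace E y) x₀).baseSet :=
  ⟨hx, mem_baseSet_cotangent hx⟩

lemma continuousLinearMapAt_cotangent {x₀ x : M} (hx : x ∈ (chartAt E x₀).source)
    (ξ : CotangentSpace E x) :
    (trivializationAt (E →L[ℝ] ℝ) (fun y : M ↦ CotangentSpace E y) x₀).continuousLinearMapAt ℝ x ξ =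
      ContinuousLinearMap.precomp ℝ (ofCoord x₀ x) ξ := by
  rw [Trivialization.continuousLinearMapAt_apply_of_mem _ _ (mem_baseSet_cotangent hx),
    trivializationAt_cotangent_apply]

lemma continuousLinearMapAt_genTangent {x₀ x : M} (hx : x ∈ (chartAt E x₀).source)
    (w : GenTangentSpace E x) :
    (trivializationAt (E × (E →L[ℝ] ℝ)) (fun y : M ↦ GenTangentSpace E y) x₀).continuousLinearMapAt
      ℝ x w = toCoordGen x₀ x w := by
  rw [Trivialization.continuousLinearMapAt_apply_of_mem _ _ (mem_baseSet_genTangent hx),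
    trivializationAt_genTangent_apply hx]

lemma symmL_genTangent {x₀ x : M} (hx : x ∈ (chartAt E x₀).source) (w : E × (E →L[ℝ] ℝ)) :
    (trivializationAt (E × (E →L[ℝ] ℝ)) (fun y : M ↦ GenTangentSpace E y) x₀).symmL ℝ x w =
      ofCoordGen x₀ x w := by
  rw [← Trivialization.symmL_continuousLinearMapAt (R := ℝ) _ (mem_baseSet_genTangent hx)
    (ofCoordGen x₀ x w), continuousLinearMapAt_genTangent hx, toCoordGen_ofCoordGen hx]

lemma contMDiffAt_endField_iff {a : Π x : M, TangentSpace 𝓘(ℝ, E) x →L[ℝ] TangentSpace 𝓘(ℝ, E) x}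
    {x₀ : M} :
    ContMDiffAt 𝓘(ℝ, E) (𝓘(ℝ, E).prod 𝓘(ℝ, E →L[ℝ] E)) ∞
      (fun x ↦ TotalSpace.mk' (E →L[ℝ] E) (E := fun y : M ↦
      (TangentSpace 𝓘(ℝ, E) y →L[ℝ] TangentSpace 𝓘(ℝ, E) y)) x (a x)) x₀ ↔
      ContMDiffAt 𝓘(ℝ, E) 𝓘(ℝ, E →L[ℝ] E) ∞
        (fun x ↦ (toCoord x₀ x).comp ((a x).comp (ofCoord x₀ x))) x₀ := by
  rw [contMDiffAt_hom_bundle]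
  exact and_iff_right contMDiffAt_id

/-- The target `T*M` is itself a bundle of homomorphisms, so its trivialization has to be unfolded a
second time. That identification holds only over the chart domain, hence the passage to eventual
equality. -/
lemma contMDiffAt_form_iff {B : Π x : M, TangentSpace 𝓘(ℝ, E) x →L[ℝ] CotangentSpace E x}
    {x₀ : M} :
    ContMDiffAt 𝓘(ℝ, E) (𝓘(ℝ, E).prod 𝓘(ℝ, E →L[ℝ] E →L[ℝ] ℝ)) ∞
      (fun x ↦ TotalSpace.mk' (E →L[ℝ] E →L[ℝ] ℝ) (E := fun y : M ↦
      (TangentSpace 𝓘(ℝ, E) y →L[ℝ] CotangentSpace E y)) x (B x)) x₀ ↔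
      ContMDiffAt 𝓘(ℝ, E) 𝓘(ℝ, E →L[ℝ] E →L[ℝ] ℝ) ∞
        (fun x ↦ (ContinuousLinearMap.precomp ℝ (ofCoord x₀ x)).comp
          ((B x).comp (ofCoord x₀ x))) x₀ := by
  rw [contMDiffAt_hom_bundle]
  refine (and_iff_right contMDiffAt_id).trans ?_
  apply Filter.EventuallyEq.contMDiffAt_iff
  filter_upwards [(chartAt E x₀).open_source.mem_nhds (mem_chart_source E x₀)] with x hx
  ext1 u
  exact continuousLinearMapAt_cotangent hx (B x (ofCoord x₀ x u))

lemma contMDiffAt_genSection_iff {α : Π x : M, GenTangentSpace E x} {x₀ : M} :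
    ContMDiffAt 𝓘(ℝ, E) (𝓘(ℝ, E).prod 𝓘(ℝ, E × (E →L[ℝ] ℝ))) ∞
    (fun x ↦ TotalSpace.mk' (E × (E →L[ℝ] ℝ)) (E := fun y : M ↦ GenTangentSpace E y) x (α x)) x₀ ↔
      ContMDiffAt 𝓘(ℝ, E) 𝓘(ℝ, E × (E →L[ℝ] ℝ)) ∞ (fun x ↦ toCoordGen x₀ x (α x)) x₀ := by
  rw [contMDiffAt_section]
  apply Filter.EventuallyEq.contMDiffAt_iff
  filter_upwards [(chartAt E x₀).open_source.mem_nhds (mem_chart_source E x₀)] with x hx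
  exact trivializationAt_genTangent_apply hx (α x)

lemma contMDiffAt_genEnd_iff {J : Π x : M, GenTangentSpace E x →L[ℝ] GenTangentSpace E x} {x₀ : M} :
    ContMDiffAt 𝓘(ℝ, E) (𝓘(ℝ, E).prod 𝓘(ℝ, (E × (E →L[ℝ] ℝ)) →L[ℝ] (E × (E →L[ℝ] ℝ)))) ∞
    (fun x ↦ TotalSpace.mk' ((E × (E →L[ℝ] ℝ)) →L[ℝ] (E × (E →L[ℝ] ℝ))) (E := fun y : M ↦
      (GenTangentSpace E y →L[ℝ] GenTangentSpace E y)) x (J x)) x₀ ↔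
      ContMDiffAt 𝓘(ℝ, E) 𝓘(ℝ, (E × (E →L[ℝ] ℝ)) →L[ℝ] (E × (E →L[ℝ] ℝ))) ∞
        (fun x ↦ (toCoordGen x₀ x).comp ((J x).comp (ofCoordGen x₀ x))) x₀ := by
  rw [contMDiffAt_hom_bundle]
  refine (and_iff_right contMDiffAt_id).trans ?_
  apply Filter.EventuallyEq.contMDiffAt_iff
  filter_upwards [(chartAt E x₀).open_source.mem_nhds (mem_chart_source E x₀)] with x hx
  refine ContinuousLinearMap.ext fun w ↦ ?_
  refine (continuousLinearMapAt_genTangent hx _).trans ?_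
  exact congrArg (fun w ↦ toCoordGen x₀ x (J x w)) (symmL_genTangent hx w)

end Trivializations

/-! ### Exterior derivatives and Lie brackets in a chart. -/

section ExteriorDerivative

section Flat

variable {E : Type*} [NormedAddCommGroup E] [NormedSpace ℝ E]

/-- The antisymmetric part of a bilinear form, as an alternating map. -/
def altPart : (E →L[ℝ] E →L[ℝ] ℝ) →L[ℝ] E [⋀^Fin 2]→L[ℝ] ℝ :=
  (1 / 2 : ℝ) • (ContinuousAlternatingMap.alternatizeUncurryFinCLM ℝ E ℝ (n := 1)).comp
    (ContinuousLinearMap.postcomp E (ContinuousAlternatingMap.ofSubsingletonLIE (𝕜 := ℝ) (E := E)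
      (F := ℝ) (0 : Fin 1)).toContinuousLinearEquiv.toContinuousLinearMap)

lemma altPart_apply (B : E →L[ℝ] E →L[ℝ] ℝ) (v : Fin 2 → E) :
    altPart B v = (1 / 2 : ℝ) * (B (v 0) (v 1) - B (v 1) (v 0)) := by
  simp [altPart, ContinuousAlternatingMap.alternatizeUncurryFin_apply, Fin.sum_univ_two,
    Fin.removeNth, sub_eq_add_neg, ContinuousAlternatingMap.ofSubsingletonLIE]

lemma extDeriv_ofSubsingleton_apply {η : E → E →L[ℝ] ℝ} {p : E} (hη : DifferentiableAt ℝ η p)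
    (u v : E) :
    extDeriv (fun y ↦ ContinuousAlternatingMap.ofSubsingleton ℝ E ℝ (0 : Fin 1) (η y)) p ![u, v] =
      fderiv ℝ η p u v - fderiv ℝ η p v u := by
  have h : DifferentiableAt ℝ
      (fun y ↦ ContinuousAlternatingMap.ofSubsingleton ℝ E ℝ (0 : Fin 1) (η y)) p :=
    ((ContinuousAlternatingMap.ofSubsingletonLIE (𝕜 := ℝ) (E := E) (F := ℝ)
      (0 : Fin 1)).toContinuousLinearEquiv.toContinuousLinearMap.differentiableAt).comp p hη
  rw [extDeriv_apply h, Fin.sum_univ_two]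
  have key : ∀ w z : E, fderiv ℝ (fun y ↦ η y w) p z = fderiv ℝ η p z w := fun w z ↦ by
    rw [fderiv_clm_apply hη (differentiableAt_const w)]
    simp
  simp [Fin.removeNth, key, sub_eq_add_neg]

/-- Near `p` the form is `altPart ∘ B`, a continuous linear function of `B`; the factor `1/2` in
`altPart` makes it recover a form from its own bilinear map. Differentiability thus passes from `B`
to `θ`. -/
lemma extDeriv_apply_of_bilin {θ : E → E [⋀^Fin 2]→L[ℝ] ℝ} {B : E → E →L[ℝ] E →L[ℝ] ℝ} {p : E}
    (hB : DifferentiableAt ℝ B p) (h : ∀ᶠ y in nhds p, ∀ u v, θ y ![u, v] = B y u v) (u v w : E) :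
    extDeriv θ p ![u, v, w] =
      fderiv ℝ B p u v w - fderiv ℝ B p v u w + fderiv ℝ B p w u v := by
  have hθ : θ =ᶠ[nhds p] fun y ↦ altPart (B y) := by
    filter_upwards [h] with y hy
    ext v
    rw [altPart_apply]
    have h1 : v = ![v 0, v 1] := by ext i; fin_cases i <;> rfl
    have h2 : θ y ![v 1, v 0] = - θ y ![v 0, v 1] := by
      have := (θ y).map_swap ![v 0, v 1] (i := 0) (j := 1) (by decide)
      refine Eq.trans (congrArg (θ y) ?_) this
      ext i; fin_cases i <;> simp
    rw [h1, ← hy, ← hy]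
    simp only [Matrix.cons_val_zero, Matrix.cons_val_one]
    rw [h2]
    ring
  have hd : DifferentiableAt ℝ θ p :=
    (((altPart (E := E)).differentiableAt (x := B p)).comp p hB).congr_of_eventuallyEq hθ
  rw [extDeriv_apply hd, Fin.sum_univ_three]
  have key : ∀ a b z : E, fderiv ℝ (fun y ↦ θ y ![a, b]) p z = fderiv ℝ B p z a b := by
    intro a b z
    have h3 : (fun y ↦ θ y ![a, b]) =ᶠ[nhds p] fun y ↦ B y a b := by
      filter_upwards [h] with y hy using hy a b
    rw [h3.fderiv_eq, fderiv_clm_apply (hB.clm_apply (differentiableAt_const a))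
      (differentiableAt_const b), fderiv_clm_apply hB (differentiableAt_const a)]
    simp
  have r0 : Fin.removeNth 0 ![u, v, w] = ![v, w] := by ext i; fin_cases i <;> rfl
  have r1 : Fin.removeNth 1 ![u, v, w] = ![u, w] := by ext i; fin_cases i <;> rfl
  have r2 : Fin.removeNth 2 ![u, v, w] = ![u, v] := by ext i; fin_cases i <;> rfl
  rw [r0, r1, r2, key, key, key]
  simp
  ring

end Flat

section Chart

variable {E : Type*} [NormedAddCommGroup E] [NormedSpace ℝ E]
  {M : Type*} [TopologicalSpace M] [ChartedSpace E M]

lemma differentiableAt_comp_extChartAt_symm {V : Type*} [NormedAddCommGroup V] [NormedSpace ℝ V]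
    {F : M → V} {x₀ : M} (hF : ContMDiffAt 𝓘(ℝ, E) 𝓘(ℝ, V) ∞ F x₀) :
    DifferentiableAt ℝ (F ∘ (extChartAt 𝓘(ℝ, E) x₀).symm) (extChartAt 𝓘(ℝ, E) x₀ x₀) := by
  have h := (contMDiffAt_iff.1 hF).2
  simp only [modelWithCornersSelf_coe, Set.range_id, contDiffWithinAt_univ] at h
  exact h.differentiableAt (by simp)

lemma extChartAt_symm_mem {x₀ : M} {y : E} (hy : y ∈ (extChartAt 𝓘(ℝ, E) x₀).target) :
    (extChartAt 𝓘(ℝ, E) x₀).symm y ∈ (chartAt E x₀).source := by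
  simpa using (extChartAt 𝓘(ℝ, E) x₀).map_target hy

lemma eventually_mem_target (x₀ : M) :
    ∀ᶠ y in nhds (extChartAt 𝓘(ℝ, E) x₀ x₀), y ∈ (extChartAt 𝓘(ℝ, E) x₀).target :=
  extChartAt_target_mem_nhds x₀

lemma dFun_apply {f : M → ℝ} {x₀ : M} (hf : ContMDiffAt 𝓘(ℝ, E) 𝓘(ℝ, ℝ) ∞ f x₀)
    (v : TangentSpace 𝓘(ℝ, E) x₀) :
    dFun f x₀ v = fderiv ℝ (f ∘ (extChartAt 𝓘(ℝ, E) x₀).symm) (extChartAt 𝓘(ℝ, E) x₀ x₀) v := by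
  have h := (hf.mdifferentiableAt (by simp)).hasMFDerivAt.2
  simp only [writtenInExtChartAt, modelWithCornersSelf_coe, Set.range_id] at h
  let L : E →L[ℝ] ℝ := mfderiv 𝓘(ℝ, E) 𝓘(ℝ, ℝ) f x₀
  have h' : HasFDerivAt (f ∘ (extChartAt 𝓘(ℝ, E) x₀).symm) L (extChartAt 𝓘(ℝ, E) x₀ x₀) :=
    hasFDerivWithinAt_univ.1 h
  exact DFunLike.congr_fun h'.fderiv.symm v

variable [IsManifold 𝓘(ℝ, E) ∞ M]

/-- The trivialization at `x₀` is the identity on the fibre over `x₀`. Values at the base point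
therefore need no conversion, and only derivatives see the chart. -/
lemma toCoord_self (x₀ : M) (v : TangentSpace 𝓘(ℝ, E) x₀) : toCoord x₀ x₀ v = v := by
  rw [toCoord, TangentBundle.continuousLinearMapAt_trivializationAt (mem_chart_source E x₀),
    mfderiv_extChartAt_self]
  rfl

lemma ofCoord_self (x₀ : M) (v : E) : ofCoord x₀ x₀ v = v := by
  conv_lhs => rw [← toCoord_self x₀ v]
  exact ofCoord_toCoord (mem_chart_source E x₀) v

lemma mfderiv_extChartAt_symm {x₀ : M} {y : E} (hy : y ∈ (extChartAt 𝓘(ℝ, E) x₀).target) :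
    @Eq (E →L[ℝ] TangentSpace 𝓘(ℝ, E) ((extChartAt 𝓘(ℝ, E) x₀).symm y))
      (mfderiv 𝓘(ℝ, E) 𝓘(ℝ, E) (extChartAt 𝓘(ℝ, E) x₀).symm y)
      (ofCoord x₀ ((extChartAt 𝓘(ℝ, E) x₀).symm y)) := by
  have h := TangentBundle.symmL_trivializationAt (I := 𝓘(ℝ, E)) (extChartAt_symm_mem hy)
  simp only [modelWithCornersSelf_coe, Set.range_id, mfderivWithin_univ] at h
  -- The trivialization lemma differentiates at the image of `symm y` under the chart, which equals
  -- `y` only propositionally. The equality is transported in the model space `E`, since the tangent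
  -- fibres depend on the point.
  have h2 : ∀ z, z = y → @Eq (E →L[ℝ] E)
      (mfderiv 𝓘(ℝ, E) 𝓘(ℝ, E) (extChartAt 𝓘(ℝ, E) x₀).symm y)
      (mfderiv 𝓘(ℝ, E) 𝓘(ℝ, E) (extChartAt 𝓘(ℝ, E) x₀).symm z) := by
    rintro _ rfl
    rfl
  exact (h2 _ ((extChartAt 𝓘(ℝ, E) x₀).right_inv hy)).trans h.symm

/-- The pullback of a vector field by the inverse chart is its expression in the trivialization, and
the chart has identity derivative at its centre. -/
lemma mlieBracket_eq_lieBracket (X Y : Π x : M, TangentSpace 𝓘(ℝ, E) x) (x₀ : M) :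
    VectorField.mlieBracket 𝓘(ℝ, E) X Y x₀ =
      VectorField.lieBracket ℝ ((fun x ↦ toCoord x₀ x (X x)) ∘ (extChartAt 𝓘(ℝ, E) x₀).symm)
        ((fun x ↦ toCoord x₀ x (Y x)) ∘ (extChartAt 𝓘(ℝ, E) x₀).symm)
        (extChartAt 𝓘(ℝ, E) x₀ x₀) := by
  have key : ∀ Z : Π x : M, TangentSpace 𝓘(ℝ, E) x,
      VectorField.mpullbackWithin 𝓘(ℝ, E) 𝓘(ℝ, E) (extChartAt 𝓘(ℝ, E) x₀).symm Z Set.univ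
        =ᶠ[nhds (extChartAt 𝓘(ℝ, E) x₀ x₀)]
      ((fun x ↦ toCoord x₀ x (Z x)) ∘ (extChartAt 𝓘(ℝ, E) x₀).symm) := by
    intro Z
    filter_upwards [eventually_mem_target x₀] with y hy
    rw [VectorField.mpullbackWithin_apply, mfderivWithin_univ, mfderiv_extChartAt_symm hy]
    have h : (ofCoord x₀ ((extChartAt 𝓘(ℝ, E) x₀).symm y)).inverse =
        toCoord x₀ ((extChartAt 𝓘(ℝ, E) x₀).symm y) := ContinuousLinearMap.inverse_eq
      (ContinuousLinearMap.ext fun v ↦ ofCoord_toCoord (extChartAt_symm_mem hy) v)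
      (ContinuousLinearMap.ext fun v ↦ toCoord_ofCoord (extChartAt_symm_mem hy) v)
    exact congrArg (fun L : TangentSpace 𝓘(ℝ, E) ((extChartAt 𝓘(ℝ, E) x₀).symm y) →L[ℝ] E ↦
      L (Z ((extChartAt 𝓘(ℝ, E) x₀).symm y))) h
  rw [← VectorField.mlieBracketWithin_univ, VectorField.mlieBracketWithin_apply]
  simp only [modelWithCornersSelf_coe, Set.range_id, Set.preimage_univ, Set.inter_univ]
  rw [mfderiv_extChartAt_self]
  have h : ∀ w : E, (ContinuousLinearMap.id ℝ E).inverse w = w := fun w ↦ by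
    rw [ContinuousLinearMap.inverse_id]; rfl
  refine (h _).trans ?_
  refine (congrFun VectorField.lieBracketWithin_univ _).trans ?_
  exact (key X).lieBracket_vectorField_eq (key Y)

lemma dOne_apply {η : Π x : M, CotangentSpace E x} {x₀ : M}
    (hη : ContMDiffAt 𝓘(ℝ, E) 𝓘(ℝ, E →L[ℝ] ℝ) ∞
      (fun x ↦ (η x).comp (ofCoord x₀ x)) x₀) (u v : E) :
    dOne η x₀ ![u, v] =
      fderiv ℝ ((fun x ↦ (η x).comp (ofCoord x₀ x)) ∘ (extChartAt 𝓘(ℝ, E) x₀).symm)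
        (extChartAt 𝓘(ℝ, E) x₀ x₀) u v -
      fderiv ℝ ((fun x ↦ (η x).comp (ofCoord x₀ x)) ∘ (extChartAt 𝓘(ℝ, E) x₀).symm)
        (extChartAt 𝓘(ℝ, E) x₀ x₀) v u := by
  rw [← extDeriv_ofSubsingleton_apply (differentiableAt_comp_extChartAt_symm hη)]
  rw [dOne, mextDeriv, mfderiv_extChartAt_self]
  have : formInChart (fun y ↦ ContinuousAlternatingMap.ofSubsingleton ℝ (TangentSpace 𝓘(ℝ, E) y) ℝ
    (0 : Fin 1) (η y)) x₀ =ᶠ[nhds (extChartAt 𝓘(ℝ, E) x₀ x₀)] (fun y ↦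
      ContinuousAlternatingMap.ofSubsingleton ℝ E ℝ (0 : Fin 1)
      (((fun x ↦ (η x).comp (ofCoord x₀ x)) ∘ (extChartAt 𝓘(ℝ, E) x₀).symm) y)) := by
    filter_upwards [eventually_mem_target x₀] with y hy
    ext v
    simp only [formInChart]
    rw [mfderiv_extChartAt_symm hy]
    rfl
  rw [this.extDeriv_eq]
  rfl

lemma mextDeriv_apply {θ : Π x : M, TangentSpace 𝓘(ℝ, E) x [⋀^Fin 2]→L[ℝ] ℝ}
    {B : Π x : M, TangentSpace 𝓘(ℝ, E) x →L[ℝ] CotangentSpace E x}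
    (hθ : ∀ x u v, θ x ![u, v] = B x u v) {x₀ : M}
    (hB : ContMDiffAt 𝓘(ℝ, E) 𝓘(ℝ, E →L[ℝ] E →L[ℝ] ℝ) ∞
        (fun x ↦ (ContinuousLinearMap.precomp ℝ (ofCoord x₀ x)).comp
          ((B x).comp (ofCoord x₀ x))) x₀) (u v w : E) :
    letI D := fderiv ℝ ((fun x ↦ (ContinuousLinearMap.precomp ℝ (ofCoord x₀ x)).comp
          ((B x).comp (ofCoord x₀ x))) ∘ (extChartAt 𝓘(ℝ, E) x₀).symm)
        (extChartAt 𝓘(ℝ, E) x₀ x₀)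
    mextDeriv θ x₀ ![u, v, w] = D u v w - D v u w + D w u v := by
  rw [← extDeriv_apply_of_bilin (θ := formInChart θ x₀)
    (differentiableAt_comp_extChartAt_symm hB), mextDeriv, mfderiv_extChartAt_self]
  · rfl
  filter_upwards [eventually_mem_target x₀] with y hy u v
  simp only [formInChart]
  rw [mfderiv_extChartAt_symm hy]
  have h := hθ ((extChartAt 𝓘(ℝ, E) x₀).symm y) (ofCoord x₀ _ u) (ofCoord x₀ _ v)
  refine Eq.trans ?_ h
  simp only [ContinuousAlternatingMap.compContinuousLinearMap_apply]
  congr 1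
  ext i; fin_cases i <;> rfl

end Chart

end ExteriorDerivative

/-! ### The Courant bracket as a function of the 1-jets of sections. -/

section SmoothSections

variable {E : Type*} [NormedAddCommGroup E] [NormedSpace ℝ E]
  {M : Type*} [TopologicalSpace M] [ChartedSpace E M] [IsManifold 𝓘(ℝ, E) ∞ M]

/-- Smoothness at `x₀` of a section of `TM ⊕ T*M`, in the trivialization at `x₀`. -/
def SmoothSectionAt (α : Π x : M, GenTangentSpace E x) (x₀ : M) : Prop :=
  ContMDiffAt 𝓘(ℝ, E) 𝓘(ℝ, E × (E →L[ℝ] ℝ)) ∞ (fun x ↦ toCoordGen x₀ x (α x)) x₀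

lemma isSmoothSection_iff {α : Π x : M, GenTangentSpace E x} :
    IsSmoothSection α ↔ ∀ x₀, SmoothSectionAt α x₀ :=
  forall_congr' fun _ ↦ contMDiffAt_genSection_iff

/-- The expression of a section of `TM ⊕ T*M` in the chart at `x₀`. -/
def sectionInChart (x₀ : M) (α : Π x : M, GenTangentSpace E x) : E → E × (E →L[ℝ] ℝ) :=
  (fun x ↦ toCoordGen x₀ x (α x)) ∘ (extChartAt 𝓘(ℝ, E) x₀).symm

/-- The derivative at `x₀` of the expression of a section of `TM ⊕ T*M` in the chart at `x₀`. -/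
def sectionDeriv (x₀ : M) (α : Π x : M, GenTangentSpace E x) : E →L[ℝ] E × (E →L[ℝ] ℝ) :=
  fderiv ℝ (sectionInChart x₀ α) (extChartAt 𝓘(ℝ, E) x₀ x₀)

lemma SmoothSectionAt.hasFDerivAt {α : Π x : M, GenTangentSpace E x} {x₀ : M}
    (h : SmoothSectionAt α x₀) :
    HasFDerivAt (sectionInChart x₀ α) (sectionDeriv x₀ α) (extChartAt 𝓘(ℝ, E) x₀ x₀) :=
  (differentiableAt_comp_extChartAt_symm h).hasFDerivAt

lemma sectionInChart_self_fst (x₀ : M) (α : Π x : M, GenTangentSpace E x) :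
    (sectionInChart x₀ α (extChartAt 𝓘(ℝ, E) x₀ x₀)).1 = (α x₀).1 :=
  (congrArg (fun x ↦ (toCoordGen x₀ x (α x)).1) (extChartAt_to_inv x₀)).trans (toCoord_self x₀ _)

lemma sectionInChart_self_snd (x₀ : M) (α : Π x : M, GenTangentSpace E x) (w : E) :
    (sectionInChart x₀ α (extChartAt 𝓘(ℝ, E) x₀ x₀)).2 w = (α x₀).2 w :=
  (congrArg (fun x ↦ (toCoordGen x₀ x (α x)).2 w) (extChartAt_to_inv x₀)).trans
    (congrArg (α x₀).2 (ofCoord_self x₀ w))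

lemma courantBracket_fst {α β : Π x : M, GenTangentSpace E x} {x₀ : M}
    (hα : SmoothSectionAt α x₀) (hβ : SmoothSectionAt β x₀) :
    (courantBracket α β x₀).1 =
      (sectionDeriv x₀ β (α x₀).1).1 - (sectionDeriv x₀ α (β x₀).1).1 := by
  refine (mlieBracket_eq_lieBracket _ _ x₀).trans ?_
  have h1 : HasFDerivAt ((fun x ↦ toCoord x₀ x (α x).1) ∘ (extChartAt 𝓘(ℝ, E) x₀).symm)
      ((ContinuousLinearMap.fst ℝ E (E →L[ℝ] ℝ)).comp (sectionDeriv x₀ α))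
      (extChartAt 𝓘(ℝ, E) x₀ x₀) := hα.hasFDerivAt.fst
  have h2 : HasFDerivAt ((fun x ↦ toCoord x₀ x (β x).1) ∘ (extChartAt 𝓘(ℝ, E) x₀).symm)
      ((ContinuousLinearMap.fst ℝ E (E →L[ℝ] ℝ)).comp (sectionDeriv x₀ β))
      (extChartAt 𝓘(ℝ, E) x₀ x₀) := hβ.hasFDerivAt.fst
  refine (congrFun (VectorField.lieBracket_eq (𝕜 := ℝ) (E := E)) _).trans ?_
  refine (congrArg₂ (fun A B : E →L[ℝ] E ↦ A _ - B _) h2.fderiv h1.fderiv).trans ?_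
  have e1 := sectionInChart_self_fst x₀ α
  have e2 := sectionInChart_self_fst x₀ β
  exact congrArg₂ (fun a b : E ↦ (sectionDeriv x₀ β a).1 - (sectionDeriv x₀ α b).1) e1 e2

lemma contMDiffAt_pairing {α β : Π x : M, GenTangentSpace E x} {x₀ : M}
    (hα : SmoothSectionAt α x₀) (hβ : SmoothSectionAt β x₀) :
    ContMDiffAt 𝓘(ℝ, E) 𝓘(ℝ, ℝ) ∞ (fun y ↦ (β y).2 (α y).1) x₀ := by
  have h1 : ContMDiffAt 𝓘(ℝ, E) 𝓘(ℝ, E →L[ℝ] ℝ) ∞ (fun x ↦ (toCoordGen x₀ x (β x)).2) x₀ :=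
    (ContinuousLinearMap.snd ℝ E (E →L[ℝ] ℝ)).contMDiff.contMDiffAt.comp x₀ hβ
  have h2 : ContMDiffAt 𝓘(ℝ, E) 𝓘(ℝ, E) ∞ (fun x ↦ (toCoordGen x₀ x (α x)).1) x₀ :=
    (ContinuousLinearMap.fst ℝ E (E →L[ℝ] ℝ)).contMDiff.contMDiffAt.comp x₀ hα
  refine (h1.clm_apply h2).congr_of_eventuallyEq ?_
  filter_upwards [(chartAt E x₀).open_source.mem_nhds (mem_chart_source E x₀)] with x hx
  exact congrArg (β x).2 (ofCoord_toCoord hx (α x).1).symm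

lemma dFun_pairing_apply {α β : Π x : M, GenTangentSpace E x} {x₀ : M}
    (hα : SmoothSectionAt α x₀) (hβ : SmoothSectionAt β x₀) (w : E) :
    dFun (fun y ↦ (β y).2 (α y).1) x₀ w =
      (sectionDeriv x₀ β w).2 (α x₀).1 + (β x₀).2 (sectionDeriv x₀ α w).1 := by
  refine (dFun_apply (contMDiffAt_pairing hα hβ) w).trans ?_
  have h : (fun y ↦ (β y).2 (α y).1) ∘ (extChartAt 𝓘(ℝ, E) x₀).symm
      =ᶠ[nhds (extChartAt 𝓘(ℝ, E) x₀ x₀)]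
      fun y ↦ (sectionInChart x₀ β y).2 (sectionInChart x₀ α y).1 := by
    filter_upwards [eventually_mem_target x₀] with y hy
    exact congrArg (β _).2 (ofCoord_toCoord (extChartAt_symm_mem hy) (α _).1).symm
  rw [h.fderiv_eq, (hβ.hasFDerivAt.snd.clm_apply hα.hasFDerivAt.fst).fderiv]
  have e1 := sectionInChart_self_fst x₀ α
  have e2 := sectionInChart_self_snd x₀ β (sectionDeriv x₀ α w).1
  rw [add_comm]
  exact congrArg₂ (· + ·) (congrArg (fun a : E ↦ (sectionDeriv x₀ β w).2 a) e1) e2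

/-- In Cartan's formula the term `(∂_w η)(X)` occurs in `i_X dη` and in `d(η(X))` with opposite
signs and cancels. -/
lemma lieOne_apply {α β : Π x : M, GenTangentSpace E x} {x₀ : M}
    (hα : SmoothSectionAt α x₀) (hβ : SmoothSectionAt β x₀) (w : E) :
    lieOne (fun y ↦ (α y).1) (fun y ↦ (β y).2) x₀ w =
      (sectionDeriv x₀ β (α x₀).1).2 w + (β x₀).2 (sectionDeriv x₀ α w).1 := by
  have h : ContMDiffAt 𝓘(ℝ, E) 𝓘(ℝ, E →L[ℝ] ℝ) ∞
      (fun x ↦ (β x).2.comp (ofCoord x₀ x)) x₀ :=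
    (ContinuousLinearMap.snd ℝ E (E →L[ℝ] ℝ)).contMDiff.contMDiffAt.comp x₀ hβ
  have h2 : HasFDerivAt ((fun x ↦ (β x).2.comp (ofCoord x₀ x)) ∘ (extChartAt 𝓘(ℝ, E) x₀).symm)
      ((ContinuousLinearMap.snd ℝ E (E →L[ℝ] ℝ)).comp (sectionDeriv x₀ β))
      (extChartAt 𝓘(ℝ, E) x₀ x₀) := hβ.hasFDerivAt.snd
  have h3 := dOne_apply h (α x₀).1 w
  rw [h2.fderiv] at h3
  have h4 : contract (α x₀).1 (dOne (fun y ↦ (β y).2) x₀) w =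
      (sectionDeriv x₀ β (α x₀).1).2 w - (sectionDeriv x₀ β w).2 (α x₀).1 :=
    (contract_apply _ _ _).trans h3
  have h5 := dFun_pairing_apply hα hβ w
  have h6 : lieOne (fun y ↦ (α y).1) (fun y ↦ (β y).2) x₀ w =
    contract (α x₀).1 (dOne (fun y ↦ (β y).2) x₀) w + dFun (fun y ↦ (β y).2 (α y).1) x₀ w := rfl
  rw [h6, h4, h5]
  ring

lemma courantBracket_snd_apply {α β : Π x : M, GenTangentSpace E x} {x₀ : M}
    (hα : SmoothSectionAt α x₀) (hβ : SmoothSectionAt β x₀) (w : E) :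
    (courantBracket α β x₀).2 w =
      (sectionDeriv x₀ β (α x₀).1).2 w - (sectionDeriv x₀ α (β x₀).1).2 w +
      (1 / 2 : ℝ) * ((β x₀).2 (sectionDeriv x₀ α w).1 - (α x₀).2 (sectionDeriv x₀ β w).1
        + (sectionDeriv x₀ α w).2 (β x₀).1 - (sectionDeriv x₀ β w).2 (α x₀).1) := by
  have h : dFun (fun y ↦ (β y).2 (α y).1 - (α y).2 (β y).1) x₀ w =
    dFun (fun y ↦ (β y).2 (α y).1) x₀ w - dFun (fun y ↦ (α y).2 (β y).1) x₀ w := by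
    have h1 := contMDiffAt_pairing hα hβ
    have h2 := contMDiffAt_pairing hβ hα
    refine (dFun_apply (h1.sub h2) w).trans (Eq.trans ?_
      (congrArg₂ (· - ·) (dFun_apply h1 w) (dFun_apply h2 w)).symm)
    exact DFunLike.congr_fun (fderiv_fun_sub (differentiableAt_comp_extChartAt_symm h1)
      (differentiableAt_comp_extChartAt_symm h2)) w
  have h6 : (courantBracket α β x₀).2 w = lieOne (fun y ↦ (α y).1) (fun y ↦ (β y).2) x₀ w
      - lieOne (fun y ↦ (β y).1) (fun y ↦ (α y).2) x₀ w
      - (1 / 2 : ℝ) • dFun (fun y ↦ (β y).2 (α y).1 - (α y).2 (β y).1) x₀ w := rfl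
  rw [h6, h, lieOne_apply hα hβ, lieOne_apply hβ hα, dFun_pairing_apply hα hβ,
    dFun_pairing_apply hβ hα, smul_eq_mul]
  ring

end SmoothSections

/-! ### Algebra of the Courant bracket and its relation to `dB`. -/

section CourantBracket

section Flat

variable {E : Type*} [NormedAddCommGroup E] [NormedSpace ℝ E]

/-- The Courant bracket of two sections on a vector space, in terms of their values `a`, `b` and
their derivatives `A`, `B` at a point. -/
def jetBracket (a b : E × (E →L[ℝ] ℝ)) (A B : E →L[ℝ] E × (E →L[ℝ] ℝ)) : E × (E →L[ℝ] ℝ) :=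
  ((B a.1).1 - (A b.1).1,
    (B a.1).2 - (A b.1).2 + (1 / 2 : ℝ) •
      (b.2.comp ((ContinuousLinearMap.fst ℝ E (E →L[ℝ] ℝ)).comp A)
        - a.2.comp ((ContinuousLinearMap.fst ℝ E (E →L[ℝ] ℝ)).comp B)
        + ((ContinuousLinearMap.snd ℝ E (E →L[ℝ] ℝ)).comp A).flip b.1
        - ((ContinuousLinearMap.snd ℝ E (E →L[ℝ] ℝ)).comp B).flip a.1))

lemma jetBracket_swap (a b : E × (E →L[ℝ] ℝ)) (A B : E →L[ℝ] E × (E →L[ℝ] ℝ)) :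
    jetBracket b a B A = -jetBracket a b A B := by
  refine Prod.ext (by simp [jetBracket]) (ContinuousLinearMap.ext fun w ↦ ?_)
  simp [jetBracket]
  ring

lemma jetBracket_add_right (a b c : E × (E →L[ℝ] ℝ)) (A B C : E →L[ℝ] E × (E →L[ℝ] ℝ)) :
    jetBracket a (b + c) A (B + C) = jetBracket a b A B + jetBracket a c A C := by
  refine Prod.ext (by simp [jetBracket]; abel) (ContinuousLinearMap.ext fun w ↦ ?_)
  simp [jetBracket]
  ring

/-- Here `r • B + l.smulRight b` is the derivative of `f b` when `f` has value `r` and differential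
`l`. The last term is the failure of the Leibniz rule, due to the exact term in the bracket. -/
lemma jetBracket_smul_right (r : ℝ) (l : E →L[ℝ] ℝ) (a b : E × (E →L[ℝ] ℝ))
    (A B : E →L[ℝ] E × (E →L[ℝ] ℝ)) :
    jetBracket a (r • b) A (r • B + l.smulRight b) = r • jetBracket a b A B + l a.1 • b
      - ((1 / 2 : ℝ) * (b.2 a.1 + a.2 b.1)) • (0, l) := by
  refine Prod.ext (by simp [jetBracket, smul_sub]; abel) (ContinuousLinearMap.ext fun w ↦ ?_)
  simp [jetBracket]
  ring

end Flat

variable {E : Type*} [NormedAddCommGroup E] [NormedSpace ℝ E]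
  {M : Type*} [TopologicalSpace M] [ChartedSpace E M] [IsManifold 𝓘(ℝ, E) ∞ M]

/-- Through this formula antisymmetry, additivity and the Leibniz rule become identities for
`jetBracket`. -/
lemma courantBracket_eq {α β : Π x : M, GenTangentSpace E x} {x₀ : M}
    (hα : SmoothSectionAt α x₀) (hβ : SmoothSectionAt β x₀) :
    @Eq (E × (E →L[ℝ] ℝ)) (courantBracket α β x₀)
      (jetBracket (α x₀) (β x₀) (sectionDeriv x₀ α) (sectionDeriv x₀ β)) := by
  refine Prod.ext (courantBracket_fst hα hβ) (ContinuousLinearMap.ext fun w ↦ ?_)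
  exact courantBracket_snd_apply hα hβ w

lemma SmoothSectionAt.add {α β : Π x : M, GenTangentSpace E x} {x₀ : M}
    (hα : SmoothSectionAt α x₀) (hβ : SmoothSectionAt β x₀) :
    SmoothSectionAt (fun x ↦ α x + β x) x₀ := by
  have h := ContMDiffAt.add hα hβ
  refine h.congr_of_eventuallyEq (.of_forall fun x ↦ ?_)
  exact map_add _ _ _

lemma SmoothSectionAt.smul {f : M → ℝ} {α : Π x : M, GenTangentSpace E x} {x₀ : M}
    (hf : ContMDiffAt 𝓘(ℝ, E) 𝓘(ℝ, ℝ) ∞ f x₀) (hα : SmoothSectionAt α x₀) :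
    SmoothSectionAt (fun x ↦ f x • α x) x₀ := by
  have h := ContMDiffAt.smul hf hα
  refine h.congr_of_eventuallyEq (.of_forall fun x ↦ ?_)
  exact map_smul _ _ _

lemma SmoothSectionAt.zero (x₀ : M) :
    SmoothSectionAt (fun x ↦ (0 : GenTangentSpace E x)) x₀ := by
  refine (contMDiffAt_const (c := 0)).congr_of_eventuallyEq (.of_forall fun x ↦ ?_)
  exact map_zero _

lemma SmoothSectionAt.neg {α : Π x : M, GenTangentSpace E x} {x₀ : M}
    (hα : SmoothSectionAt α x₀) : SmoothSectionAt (fun x ↦ -α x) x₀ := by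
  refine (ContMDiffAt.neg hα).congr_of_eventuallyEq (.of_forall fun x ↦ ?_)
  exact map_neg _ _

lemma sectionDeriv_add {α β : Π x : M, GenTangentSpace E x} {x₀ : M}
    (hα : SmoothSectionAt α x₀) (hβ : SmoothSectionAt β x₀) :
    sectionDeriv x₀ (fun x ↦ α x + β x) = sectionDeriv x₀ α + sectionDeriv x₀ β := by
  refine HasFDerivAt.fderiv ((hα.hasFDerivAt.add hβ.hasFDerivAt).congr_of_eventuallyEq
    (.of_forall fun y ↦ ?_))
  exact map_add _ _ _

lemma sectionDeriv_smul {f : M → ℝ} {α : Π x : M, GenTangentSpace E x} {x₀ : M}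
    (hf : ContMDiffAt 𝓘(ℝ, E) 𝓘(ℝ, ℝ) ∞ f x₀) (hα : SmoothSectionAt α x₀)
    {l : E →L[ℝ] ℝ} (hl : l = dFun f x₀) {a : E × (E →L[ℝ] ℝ)} (ha : a = α x₀) :
    sectionDeriv x₀ (fun x ↦ f x • α x) = f x₀ • sectionDeriv x₀ α + l.smulRight a := by
  have h1 := (differentiableAt_comp_extChartAt_symm hf).hasFDerivAt
  have h2 := h1.smul hα.hasFDerivAt
  have h3 : fderiv ℝ (f ∘ (extChartAt 𝓘(ℝ, E) x₀).symm) (extChartAt 𝓘(ℝ, E) x₀ x₀) = l :=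
    ContinuousLinearMap.ext fun v ↦ (dFun_apply hf v).symm.trans (DFunLike.congr_fun hl v).symm
  have h4 : sectionInChart x₀ α (extChartAt 𝓘(ℝ, E) x₀ x₀) = a :=
    Eq.trans (Prod.ext (sectionInChart_self_fst x₀ α)
      (ContinuousLinearMap.ext (sectionInChart_self_snd x₀ α))) ha.symm
  rw [h3, h4, Function.comp_apply, extChartAt_to_inv] at h2
  refine HasFDerivAt.fderiv (h2.congr_of_eventuallyEq (.of_forall fun y ↦ ?_))
  exact map_smul (toCoordGen x₀ _) _ _

lemma courantBracket_swap {α β : Π x : M, GenTangentSpace E x} {x₀ : M}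
    (hα : SmoothSectionAt α x₀) (hβ : SmoothSectionAt β x₀) :
    courantBracket β α x₀ = -courantBracket α β x₀ :=
  (courantBracket_eq hβ hα).trans ((jetBracket_swap _ _ _ _).trans
    (congrArg (fun a : E × (E →L[ℝ] ℝ) ↦ -a) (courantBracket_eq hα hβ).symm))

lemma courantBracket_add_right {α β γ : Π x : M, GenTangentSpace E x} {x₀ : M}
    (hα : SmoothSectionAt α x₀) (hβ : SmoothSectionAt β x₀) (hγ : SmoothSectionAt γ x₀) :
    courantBracket α (fun x ↦ β x + γ x) x₀ = courantBracket α β x₀ + courantBracket α γ x₀ := by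
  refine (courantBracket_eq hα (hβ.add hγ)).trans ?_
  rw [sectionDeriv_add hβ hγ]
  exact (jetBracket_add_right _ _ _ _ _ _).trans (congrArg₂ (fun a b : E × (E →L[ℝ] ℝ) ↦ a + b)
    (courantBracket_eq hα hβ).symm (courantBracket_eq hα hγ).symm)

lemma courantBracket_add_left {α β γ : Π x : M, GenTangentSpace E x} {x₀ : M}
    (hα : SmoothSectionAt α x₀) (hβ : SmoothSectionAt β x₀) (hγ : SmoothSectionAt γ x₀) :
    courantBracket (fun x ↦ β x + γ x) α x₀ = courantBracket β α x₀ + courantBracket γ α x₀ := by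
  rw [courantBracket_swap hα (hβ.add hγ), courantBracket_add_right hα hβ hγ,
    courantBracket_swap hα hβ, courantBracket_swap hα hγ, neg_add]

lemma courantBracket_smul_right {f : M → ℝ} {α β : Π x : M, GenTangentSpace E x} {x₀ : M}
    (hf : ContMDiffAt 𝓘(ℝ, E) 𝓘(ℝ, ℝ) ∞ f x₀) (hα : SmoothSectionAt α x₀)
    (hβ : SmoothSectionAt β x₀) :
    courantBracket α (fun x ↦ f x • β x) x₀ = f x₀ • courantBracket α β x₀
      + dFun f x₀ (α x₀).1 • β x₀
      - ((1 / 2 : ℝ) * ((β x₀).2 (α x₀).1 + (α x₀).2 (β x₀).1)) •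
        ((0, dFun f x₀) : GenTangentSpace E x₀) := by
  refine (courantBracket_eq hα (hβ.smul hf)).trans ?_
  rw [sectionDeriv_smul hf hβ rfl rfl]
  refine (jetBracket_smul_right _ _ _ _ _ _).trans ?_
  let c : E × (E →L[ℝ] ℝ) := dFun f x₀ (α x₀).1 • β x₀
  let d : E × (E →L[ℝ] ℝ) := ((1 / 2 : ℝ) * ((β x₀).2 (α x₀).1 + (α x₀).2 (β x₀).1)) •
    ((0, dFun f x₀) : GenTangentSpace E x₀)
  exact congrArg (fun z : E × (E →L[ℝ] ℝ) ↦ f x₀ • z + c - d) (courantBracket_eq hα hβ).symm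

lemma courantBracket_zero_right {α : Π x : M, GenTangentSpace E x} {x₀ : M}
    (hα : SmoothSectionAt α x₀) :
    courantBracket α (fun x ↦ (0 : GenTangentSpace E x)) x₀ = 0 := by
  have h := courantBracket_add_right hα (SmoothSectionAt.zero x₀) (SmoothSectionAt.zero x₀)
  simp only [add_zero] at h
  exact left_eq_add.1 h

lemma courantBracket_neg_right {α β : Π x : M, GenTangentSpace E x} {x₀ : M}
    (hα : SmoothSectionAt α x₀) (hβ : SmoothSectionAt β x₀) :
    courantBracket α (fun x ↦ -β x) x₀ = -courantBracket α β x₀ := by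
  have h := courantBracket_add_right hα hβ hβ.neg
  simp only [add_neg_cancel] at h
  rw [courantBracket_zero_right hα] at h
  exact eq_neg_of_add_eq_zero_right h.symm

lemma courantBracket_neg_left {α β : Π x : M, GenTangentSpace E x} {x₀ : M}
    (hα : SmoothSectionAt α x₀) (hβ : SmoothSectionAt β x₀) :
    courantBracket (fun x ↦ -β x) α x₀ = -courantBracket β α x₀ := by
  rw [courantBracket_swap hα hβ.neg, courantBracket_neg_right hα hβ, courantBracket_swap hα hβ]

/-- The derivative at `x₀` of the expression of a 2-form in the chart at `x₀`. -/
def formDeriv (x₀ : M) (B : TwoForm E M) : E →L[ℝ] E →L[ℝ] E →L[ℝ] ℝ :=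
  fderiv ℝ ((fun x ↦ (ContinuousLinearMap.precomp ℝ (ofCoord x₀ x)).comp
    ((B.toFun x).comp (ofCoord x₀ x))) ∘ (extChartAt 𝓘(ℝ, E) x₀).symm) (extChartAt 𝓘(ℝ, E) x₀ x₀)

lemma hasFDerivAt_formDeriv (x₀ : M) (B : TwoForm E M) :
    HasFDerivAt ((fun x ↦ (ContinuousLinearMap.precomp ℝ (ofCoord x₀ x)).comp
      ((B.toFun x).comp (ofCoord x₀ x))) ∘ (extChartAt 𝓘(ℝ, E) x₀).symm) (formDeriv x₀ B)
      (extChartAt 𝓘(ℝ, E) x₀ x₀) :=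
  (differentiableAt_comp_extChartAt_symm (contMDiffAt_form_iff.1 (B.smooth x₀))).hasFDerivAt

lemma formDeriv_swap (x₀ : M) (B : TwoForm E M) (w u v : E) :
    formDeriv x₀ B w u v = -formDeriv x₀ B w v u := by
  have h := hasFDerivAt_formDeriv x₀ B
  have key : ∀ a b : E, HasFDerivAt (fun y ↦ ((fun x ↦ (ContinuousLinearMap.precomp ℝ
      (ofCoord x₀ x)).comp ((B.toFun x).comp (ofCoord x₀ x))) ∘ (extChartAt 𝓘(ℝ, E) x₀).symm) y a b)
      ((formDeriv x₀ B).flip a |>.flip b) (extChartAt 𝓘(ℝ, E) x₀ x₀) := fun a b ↦ by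
    refine ((h.clm_apply (hasFDerivAt_const a _)).clm_apply (hasFDerivAt_const b _)).congr_fderiv ?_
    ext z
    simp
  have h2 : HasFDerivAt _ _ _ := ((key v u).neg).congr_of_eventuallyEq (.of_forall fun y ↦
    B.swap ((extChartAt 𝓘(ℝ, E) x₀).symm y) (ofCoord x₀ _ u) (ofCoord x₀ _ v))
  exact DFunLike.congr_fun ((key u v).unique h2) w

lemma mextDeriv_toAlt_apply (x₀ : M) (B : TwoForm E M) (u v w : E) :
    mextDeriv B.toAlt x₀ ![u, v, w] =
      formDeriv x₀ B u v w - formDeriv x₀ B v u w + formDeriv x₀ B w u v :=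
  mextDeriv_apply (θ := B.toAlt) (B := B.toFun) (fun _ _ _ ↦ rfl)
    (contMDiffAt_form_iff.1 (B.smooth x₀)) u v w

/-- The section `(X, 0)` attached to a vector field `X`. -/
def vecSection (X : Π x : M, TangentSpace 𝓘(ℝ, E) x) (x : M) : GenTangentSpace E x := (X x, 0)

/-- The section `(0, ξ)` attached to a 1-form `ξ`. -/
def covSection (ξ : Π x : M, CotangentSpace E x) (x : M) : GenTangentSpace E x := (0, ξ x)

lemma toCoordGen_covSection {x₀ x : M} (hx : x ∈ (chartAt E x₀).source)
    (X : Π x : M, TangentSpace 𝓘(ℝ, E) x) (B : TwoForm E M) :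
    toCoordGen x₀ x (covSection (fun x ↦ B.toFun x (X x)) x) =
      (0, ((ContinuousLinearMap.precomp ℝ (ofCoord x₀ x)).comp
        ((B.toFun x).comp (ofCoord x₀ x))) (toCoordGen x₀ x (vecSection X x)).1) := by
  refine Prod.ext (map_zero (toCoord x₀ x)) (ContinuousLinearMap.ext fun w ↦ ?_)
  exact congrArg (fun v ↦ B.toFun x v (ofCoord x₀ x w)) (ofCoord_toCoord hx (X x)).symm

lemma SmoothSectionAt.contract {X : Π x : M, TangentSpace 𝓘(ℝ, E) x} {x₀ : M}
    (hX : SmoothSectionAt (vecSection X) x₀) (B : TwoForm E M) :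
    SmoothSectionAt (covSection fun x ↦ B.toFun x (X x)) x₀ := by
  have h1 := contMDiffAt_form_iff.1 (B.smooth x₀)
  have h2 : ContMDiffAt 𝓘(ℝ, E) 𝓘(ℝ, E) ∞ (fun x ↦ (toCoordGen x₀ x (vecSection X x)).1) x₀ :=
    (ContinuousLinearMap.fst ℝ E (E →L[ℝ] ℝ)).contMDiff.contMDiffAt.comp x₀ hX
  have h3 := (ContinuousLinearMap.inr ℝ E (E →L[ℝ] ℝ)).contMDiff.contMDiffAt.comp x₀
    (h1.clm_apply h2)
  refine h3.congr_of_eventuallyEq ?_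
  filter_upwards [(chartAt E x₀).open_source.mem_nhds (mem_chart_source E x₀)] with x hx
  exact toCoordGen_covSection hx X B

/-- Product rule for `y ↦ B_y(X_y)`. The values `b` and `v` enter through equations so that they
live in `E`-valued types, where the derivative formulas can be rewritten. -/
lemma sectionDeriv_contract_eq {X : Π x : M, TangentSpace 𝓘(ℝ, E) x} {x₀ : M}
    (hX : SmoothSectionAt (vecSection X) x₀) (B : TwoForm E M)
    {b : E →L[ℝ] E →L[ℝ] ℝ} (hb : b = B.toFun x₀) {v : E} (hv : v = X x₀) (w : E) :
    sectionDeriv x₀ (covSection fun x ↦ B.toFun x (X x)) w =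
      (0, formDeriv x₀ B w v + b (sectionDeriv x₀ (vecSection X) w).1) := by
  have h1 := (hasFDerivAt_formDeriv x₀ B).clm_apply hX.hasFDerivAt.fst
  have e1 : (sectionInChart x₀ (vecSection X) (extChartAt 𝓘(ℝ, E) x₀ x₀)).1 = v :=
    (sectionInChart_self_fst x₀ _).trans hv.symm
  have e2 : ((fun x ↦ (ContinuousLinearMap.precomp ℝ (ofCoord x₀ x)).comp
      ((B.toFun x).comp (ofCoord x₀ x))) ∘ (extChartAt 𝓘(ℝ, E) x₀).symm)
      (extChartAt 𝓘(ℝ, E) x₀ x₀) = b := by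
    rw [Function.comp_apply, extChartAt_to_inv, hb]
    refine ContinuousLinearMap.ext fun u ↦ ContinuousLinearMap.ext fun z ↦ ?_
    exact congrArg₂ (fun a c : E ↦ (B.toFun x₀ a : E →L[ℝ] ℝ) c) (ofCoord_self x₀ u)
      (ofCoord_self x₀ z)
  rw [e1, e2] at h1
  have h2 := (ContinuousLinearMap.inr ℝ E (E →L[ℝ] ℝ)).hasFDerivAt.comp _ h1
  have h3 : HasFDerivAt (sectionInChart x₀ (covSection fun x ↦ B.toFun x (X x))) _ _ :=
    h2.congr_of_eventuallyEq (by
      filter_upwards [eventually_mem_target x₀] with y hy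
      exact toCoordGen_covSection (extChartAt_symm_mem hy) X B)
  rw [sectionDeriv, h3.fderiv]
  refine Prod.ext rfl (ContinuousLinearMap.ext fun z ↦ ?_)
  simp [sectionDeriv, add_comm]

lemma sectionDeriv_contract_snd_apply {X : Π x : M, TangentSpace 𝓘(ℝ, E) x} {x₀ : M}
    (hX : SmoothSectionAt (vecSection X) x₀) (B : TwoForm E M) (w z : E) :
    (sectionDeriv x₀ (covSection fun x ↦ B.toFun x (X x)) w).2 z =
      formDeriv x₀ B w (X x₀) z + B.toFun x₀ (sectionDeriv x₀ (vecSection X) w).1 z := by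
  rw [sectionDeriv_contract_eq hX B rfl rfl]
  rfl

lemma SmoothSectionAt.vecSection_fst {α : Π x : M, GenTangentSpace E x} {x₀ : M}
    (hα : SmoothSectionAt α x₀) : SmoothSectionAt (vecSection fun x ↦ (α x).1) x₀ := by
  have h := ((ContinuousLinearMap.inl ℝ E (E →L[ℝ] ℝ)).comp
    (ContinuousLinearMap.fst ℝ E (E →L[ℝ] ℝ))).contMDiff.contMDiffAt.comp x₀ hα
  exact h.congr_of_eventuallyEq (.of_forall fun x ↦ Prod.ext rfl
    (map_zero (ContinuousLinearMap.precomp ℝ (ofCoord x₀ x))))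

lemma SmoothSectionAt.covSection_snd {α : Π x : M, GenTangentSpace E x} {x₀ : M}
    (hα : SmoothSectionAt α x₀) : SmoothSectionAt (covSection fun x ↦ (α x).2) x₀ := by
  have h := ((ContinuousLinearMap.inr ℝ E (E →L[ℝ] ℝ)).comp
    (ContinuousLinearMap.snd ℝ E (E →L[ℝ] ℝ))).contMDiff.contMDiffAt.comp x₀ hα
  exact h.congr_of_eventuallyEq (.of_forall fun x ↦ Prod.ext (map_zero (toCoord x₀ x)) rfl)

/-- A form of `courantBracket_snd_apply` in which each of the six jet terms can be evaluated
separately. -/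
lemma courantBracket_snd_eq {α β : Π x : M, GenTangentSpace E x} {x₀ : M}
    (hα : SmoothSectionAt α x₀) (hβ : SmoothSectionAt β x₀) {u v w : E}
    (hu : u = (α x₀).1) (hv : v = (β x₀).1) {r₁ r₂ r₃ r₄ r₅ r₆ : ℝ}
    (h₁ : (sectionDeriv x₀ β u).2 w = r₁) (h₂ : (sectionDeriv x₀ α v).2 w = r₂)
    (h₃ : (β x₀).2 (sectionDeriv x₀ α w).1 = r₃) (h₄ : (α x₀).2 (sectionDeriv x₀ β w).1 = r₄)
    (h₅ : (sectionDeriv x₀ α w).2 v = r₅) (h₆ : (sectionDeriv x₀ β w).2 u = r₆) :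
    (courantBracket α β x₀).2 w = r₁ - r₂ + (1 / 2 : ℝ) * (r₃ - r₄ + r₅ - r₆) := by
  rw [← h₁, ← h₂, ← h₃, ← h₄, ← h₅, ← h₆, hu, hv]
  exact courantBracket_snd_apply hα hβ w

lemma sectionDeriv_vecSection_snd_apply {X : Π x : M, TangentSpace 𝓘(ℝ, E) x} {x₀ : M}
    (hX : SmoothSectionAt (vecSection X) x₀) (w z : E) :
    (sectionDeriv x₀ (vecSection X) w).2 z = 0 := by
  have h1 := hX.hasFDerivAt.snd
  have h2 : HasFDerivAt (fun y ↦ (sectionInChart x₀ (vecSection X) y).2)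
      (0 : E →L[ℝ] E →L[ℝ] ℝ) (extChartAt 𝓘(ℝ, E) x₀ x₀) :=
    (hasFDerivAt_const (0 : E →L[ℝ] ℝ) _).congr_of_eventuallyEq
      (.of_forall fun y ↦ map_zero (ContinuousLinearMap.precomp ℝ (ofCoord x₀ _)))
  exact DFunLike.congr_fun (DFunLike.congr_fun (h1.unique h2) w) z

lemma sectionDeriv_covSection_fst {ξ : Π x : M, CotangentSpace E x} {x₀ : M}
    (hξ : SmoothSectionAt (covSection ξ) x₀) (w : E) :
    (sectionDeriv x₀ (covSection ξ) w).1 = 0 := by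
  have h1 := hξ.hasFDerivAt.fst
  have h2 : HasFDerivAt (fun y ↦ (sectionInChart x₀ (covSection ξ) y).1)
      (0 : E →L[ℝ] E) (extChartAt 𝓘(ℝ, E) x₀ x₀) :=
    (hasFDerivAt_const (0 : E) _).congr_of_eventuallyEq
      (.of_forall fun y ↦ map_zero (toCoord x₀ _))
  exact DFunLike.congr_fun (h1.unique h2) w

lemma apply_sectionDeriv_covSection_fst {ξ : Π x : M, CotangentSpace E x} {x₀ : M}
    (hξ : SmoothSectionAt (covSection ξ) x₀) (η : CotangentSpace E x₀) (w : E) :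
    η (sectionDeriv x₀ (covSection ξ) w).1 = 0 := by
  rw [sectionDeriv_covSection_fst hξ]
  exact map_zero η

lemma courantBracket_vecSection {X Y : Π x : M, TangentSpace 𝓘(ℝ, E) x} {x₀ : M}
    (hX : SmoothSectionAt (vecSection X) x₀) (hY : SmoothSectionAt (vecSection Y) x₀) :
    courantBracket (vecSection X) (vecSection Y) x₀ =
      (VectorField.mlieBracket 𝓘(ℝ, E) X Y x₀, 0) := by
  refine Prod.ext rfl (ContinuousLinearMap.ext fun w ↦ ?_)
  refine (courantBracket_snd_eq hX hY rfl rfl (sectionDeriv_vecSection_snd_apply hY _ _)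
    (sectionDeriv_vecSection_snd_apply hX _ _) rfl rfl
    (sectionDeriv_vecSection_snd_apply hX _ _) (sectionDeriv_vecSection_snd_apply hY _ _)).trans ?_
  change (0 : ℝ) - 0 + 1 / 2 * (0 - 0 + 0 - 0) = 0
  norm_num

/-- Every term of the bracket contains a vector component or the derivative of one, and for covector
fields these vanish. -/
lemma courantBracket_covSection {ξ η : Π x : M, CotangentSpace E x} {x₀ : M}
    (hξ : SmoothSectionAt (covSection ξ) x₀) (hη : SmoothSectionAt (covSection η) x₀) :
    courantBracket (covSection ξ) (covSection η) x₀ = 0 := by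
  refine Prod.ext ?_ (ContinuousLinearMap.ext fun w ↦ ?_)
  · refine (courantBracket_fst hξ hη).trans ?_
    change (sectionDeriv x₀ (covSection η) 0).1 - (sectionDeriv x₀ (covSection ξ) 0).1 = 0
    simp
  · have h : ∀ {ζ : Π x : M, CotangentSpace E x} (w : E),
        (sectionDeriv x₀ (covSection ζ) 0).2 w = 0 := by simp
    have h' : ∀ {ζ : Π x : M, CotangentSpace E x} (w : E),
        (sectionDeriv x₀ (covSection ζ) w).2 0 = 0 := by simp
    refine (courantBracket_snd_eq hξ hη (u := 0) (v := 0) rfl rfl (h w) (h w)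
      (apply_sectionDeriv_covSection_fst hξ _ w) (apply_sectionDeriv_covSection_fst hη _ w)
      (h' w) (h' w)).trans ?_
    change (0 : ℝ) - 0 + 1 / 2 * (0 - 0 + 0 - 0) = 0
    norm_num

lemma courantBracket_contract_fst {X Y : Π x : M, TangentSpace 𝓘(ℝ, E) x} {x₀ : M}
    (hX : SmoothSectionAt (vecSection X) x₀) (hY : SmoothSectionAt (vecSection Y) x₀)
    (B : TwoForm E M) :
    (courantBracket (vecSection X) (covSection fun x ↦ B.toFun x (Y x)) x₀).1 = 0 := by
  obtain ⟨u, hu⟩ : ∃ u : E, u = X x₀ := ⟨_, rfl⟩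
  have h : (courantBracket (vecSection X) (covSection fun x ↦ B.toFun x (Y x)) x₀).1 =
      (sectionDeriv x₀ (covSection fun x ↦ B.toFun x (Y x)) u).1
        - (sectionDeriv x₀ (vecSection X) 0).1 := by
    rw [hu]
    exact courantBracket_fst hX (hY.contract B)
  rw [sectionDeriv_covSection_fst (hY.contract B), map_zero] at h
  exact h.trans (sub_self (0 : E))

/-- The part of the bracket of `(X, i_X B)` and `(Y, i_Y B)` which is linear in `B` is
`i_[X, Y] B + dB(X, Y, ·)`. -/
lemma courantBracket_contract_snd {X Y : Π x : M, TangentSpace 𝓘(ℝ, E) x} {x₀ : M}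
    (hX : SmoothSectionAt (vecSection X) x₀) (hY : SmoothSectionAt (vecSection Y) x₀)
    (B : TwoForm E M) (w : TangentSpace 𝓘(ℝ, E) x₀) :
    (courantBracket (vecSection X) (covSection fun x ↦ B.toFun x (Y x)) x₀).2 w +
      (courantBracket (covSection fun x ↦ B.toFun x (X x)) (vecSection Y) x₀).2 w =
    B.toFun x₀ (VectorField.mlieBracket 𝓘(ℝ, E) X Y x₀) w +
     mextDeriv B.toAlt x₀ ![X x₀, Y x₀, w] := by
  let b : E →L[ℝ] E →L[ℝ] ℝ := B.toFun x₀
  let X' : E →L[ℝ] E :=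
    (ContinuousLinearMap.fst ℝ E (E →L[ℝ] ℝ)).comp (sectionDeriv x₀ (vecSection X))
  let Y' : E →L[ℝ] E :=
    (ContinuousLinearMap.fst ℝ E (E →L[ℝ] ℝ)).comp (sectionDeriv x₀ (vecSection Y))
  obtain ⟨u, hu⟩ : ∃ u : E, u = X x₀ := ⟨_, rfl⟩
  obtain ⟨v, hv⟩ : ∃ v : E, v = Y x₀ := ⟨_, rfl⟩
  have hXY : VectorField.mlieBracket 𝓘(ℝ, E) X Y x₀ = Y' u - X' v := by
    rw [hu, hv]
    exact courantBracket_fst hX hY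
  have h1 : (courantBracket (vecSection X) (covSection fun x ↦ B.toFun x (Y x)) x₀).2 w =
      (formDeriv x₀ B u v w + b (Y' u) w) - 0 + (1 / 2 : ℝ) * (b v (X' w) - 0 + 0 -
        (formDeriv x₀ B w v u + b (Y' w) u)) := by
    refine courantBracket_snd_eq hX (hY.contract B) hu (v := 0) rfl ?_ ?_ ?_ rfl ?_ ?_
    · rw [hv]
      exact sectionDeriv_contract_snd_apply hY B u w
    · exact (congrArg (fun L : E × (E →L[ℝ] ℝ) ↦ L.2 w) (map_zero (sectionDeriv x₀ (vecSection X))))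
    · rw [hv]
      rfl
    · exact map_zero _
    · rw [hv]
      exact sectionDeriv_contract_snd_apply hY B w u
  have h2 : (courantBracket (covSection fun x ↦ B.toFun x (X x)) (vecSection Y) x₀).2 w =
      0 - (formDeriv x₀ B v u w + b (X' v) w) + (1 / 2 : ℝ) * (0 - b u (Y' w) +
        (formDeriv x₀ B w u v + b (X' w) v) - 0) := by
    refine courantBracket_snd_eq (hX.contract B) hY (u := 0) rfl hv ?_ ?_ rfl ?_ ?_ ?_
    · exact (congrArg (fun L : E × (E →L[ℝ] ℝ) ↦ L.2 w) (map_zero (sectionDeriv x₀ (vecSection Y))))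
    · rw [hu]
      exact sectionDeriv_contract_snd_apply hX B v w
    · rw [hu]
      rfl
    · rw [hu]
      exact sectionDeriv_contract_snd_apply hX B w v
    · exact map_zero _
  have h3 : mextDeriv B.toAlt x₀ ![X x₀, Y x₀, w] =
      formDeriv x₀ B u v w - formDeriv x₀ B v u w + formDeriv x₀ B w u v := by
    rw [hu, hv]
    exact mextDeriv_toAlt_apply x₀ B (X x₀) (Y x₀) w
  have h4 : B.toFun x₀ (VectorField.mlieBracket 𝓘(ℝ, E) X Y x₀) w = b (Y' u) w - b (X' v) w := by
    rw [hXY]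
    exact DFunLike.congr_fun (map_sub b (Y' u) (X' v)) w
  have h5 : ∀ p q : E, b p q = -b q p := fun p q ↦ B.swap x₀ p q
  -- By antisymmetry of `b`, the terms with `X' w` and `Y' w` cancel. By antisymmetry of the
  -- derivative of `B`, the two halves of the derivative in direction `w` add up to the third term
  -- of `dB`.
  rw [h1, h2, h3, h4, h5 v, h5 u, formDeriv_swap x₀ B w v u]
  ring

end CourantBracket

/-! ### The torsion and its failure to be tensorial. -/

section Torsion

variable {E : Type*} [NormedAddCommGroup E] [NormedSpace ℝ E]
  {M : Type*} [TopologicalSpace M] [ChartedSpace E M] [IsManifold 𝓘(ℝ, E) ∞ M]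

section Existence

variable [FiniteDimensional ℝ E] [T2Space M]

/-- The torsion condition concerns global sections only, so pointwise conclusions need every fibre
element to extend. A bump function cuts off the section with constant coordinates. -/
lemma exists_isSmoothSection_eq (x₀ : M) (w : GenTangentSpace E x₀) :
    ∃ α : Π x : M, GenTangentSpace E x, IsSmoothSection α ∧ α x₀ = w := by
  obtain ⟨ψ⟩ : Nonempty (SmoothBumpFunction 𝓘(ℝ, E) x₀) :=
    SmoothBumpFunction.nhdsWithin_range_basis.nonempty
  refine ⟨fun x ↦ ψ x • ofCoordGen x₀ x (toCoordGen x₀ x₀ w), ?_, ?_⟩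
  · refine ContMDiffOn.smul_section_of_tsupport (u := (chartAt E x₀).source)
      (s := fun x ↦ ofCoordGen x₀ x (toCoordGen x₀ x₀ w)) ψ.contMDiff.contMDiffOn
      (chartAt E x₀).open_source ψ.tsupport_subset_chartAt_source fun y hy ↦ ?_
    refine ContMDiffAt.contMDiffWithinAt ?_
    rw [Trivialization.contMDiffAt_section_iff
      (e := trivializationAt (E × (E →L[ℝ] ℝ)) (fun y : M ↦ GenTangentSpace E y) x₀)]
    · refine (contMDiffAt_const (c := toCoordGen x₀ x₀ w)).congr_of_eventuallyEq ?_
      filter_upwards [(chartAt E x₀).open_source.mem_nhds hy] with x hx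
      exact (trivializationAt_genTangent_apply hx _).trans (toCoordGen_ofCoordGen hx _)
    · exact mem_baseSet_genTangent hy
  · simp only [ψ.eq_one, one_smul]
    exact ofCoordGen_toCoordGen (mem_chart_source E x₀) w

lemma exists_dFun_eq (x₀ : M) (ξ : CotangentSpace E x₀) :
    ∃ f : M → ℝ, ContMDiff 𝓘(ℝ, E) 𝓘(ℝ, ℝ) ∞ f ∧ dFun f x₀ = ξ := by
  obtain ⟨ψ⟩ : Nonempty (SmoothBumpFunction 𝓘(ℝ, E) x₀) :=
    SmoothBumpFunction.nhdsWithin_range_basis.nonempty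
  let l : E →L[ℝ] ℝ := ξ
  have hf : ContMDiff 𝓘(ℝ, E) 𝓘(ℝ, ℝ) ∞ (fun x ↦ ψ x • l (extChartAt 𝓘(ℝ, E) x₀ x)) :=
    ψ.contMDiff_smul (l.contMDiff.comp_contMDiffOn (contMDiffOn_extChartAt))
  refine ⟨_, hf, ContinuousLinearMap.ext fun v ↦ (dFun_apply (hf x₀) v).trans ?_⟩
  have h : (fun x ↦ ψ x • l (extChartAt 𝓘(ℝ, E) x₀ x)) ∘ (extChartAt 𝓘(ℝ, E) x₀).symm
      =ᶠ[nhds (extChartAt 𝓘(ℝ, E) x₀ x₀)] l := by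
    have h1 : Filter.Tendsto (extChartAt 𝓘(ℝ, E) x₀).symm
        (nhds (extChartAt 𝓘(ℝ, E) x₀ x₀)) (nhds x₀) := by
      have := continuousAt_extChartAt_symm (I := 𝓘(ℝ, E)) x₀
      simpa [ContinuousAt] using this
    filter_upwards [eventually_mem_target x₀, h1.eventually ψ.eventuallyEq_one] with y hy hy1
    simp only [Function.comp_apply, hy1, (extChartAt 𝓘(ℝ, E) x₀).right_inv hy]
    simp
  rw [h.fderiv_eq, l.fderiv]
  rfl

end Existence

/-- The torsion of an endomorphism of `TM ⊕ T*M` with respect to the Courant bracket. -/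
def torsion (J : Π x : M, GenTangentSpace E x →L[ℝ] GenTangentSpace E x)
    (α β : Π x : M, GenTangentSpace E x) (x : M) : GenTangentSpace E x :=
  courantBracket (fun y ↦ J y (α y)) (fun y ↦ J y (β y)) x - courantBracket α β x
      - J x (courantBracket (fun y ↦ J y (α y)) β x + courantBracket α (fun y ↦ J y (β y)) x)

section Torsion

variable {J : Π x : M, GenTangentSpace E x →L[ℝ] GenTangentSpace E x} {x₀ : M}
  {α β γ : Π x : M, GenTangentSpace E x}

lemma torsion_swap (hα : SmoothSectionAt α x₀) (hβ : SmoothSectionAt β x₀)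
    (hJα : SmoothSectionAt (fun x ↦ J x (α x)) x₀) (hJβ : SmoothSectionAt (fun x ↦ J x (β x)) x₀) :
    torsion J β α x₀ = -torsion J α β x₀ := by
  simp only [torsion]
  rw [courantBracket_swap hJα hJβ, courantBracket_swap hα hβ, courantBracket_swap hα hJβ,
    courantBracket_swap hJα hβ, ← neg_add, map_neg, add_comm (courantBracket α _ x₀)]
  abel

lemma torsion_add_right (hα : SmoothSectionAt α x₀) (hβ : SmoothSectionAt β x₀)
    (hγ : SmoothSectionAt γ x₀)
    (hJα : SmoothSectionAt (fun x ↦ J x (α x)) x₀) (hJβ : SmoothSectionAt (fun x ↦ J x (β x)) x₀)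
    (hJγ : SmoothSectionAt (fun x ↦ J x (γ x)) x₀) :
    torsion J α (fun x ↦ β x + γ x) x₀ = torsion J α β x₀ + torsion J α γ x₀ := by
  simp only [torsion, map_add]
  rw [courantBracket_add_right hJα hJβ hJγ, courantBracket_add_right hα hβ hγ,
    courantBracket_add_right hα hJβ hJγ, courantBracket_add_right hJα hβ hγ, map_add, map_add]
  abel

/-- Substituting `J(Jβ) = -β` permutes the four brackets up to sign and a factor `J`. -/
lemma torsion_apply_right (hJ : ∀ x v, J x (J x v) = -v) (hα : SmoothSectionAt α x₀)
    (hβ : SmoothSectionAt β x₀) (hJα : SmoothSectionAt (fun x ↦ J x (α x)) x₀) :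
    torsion J α (fun x ↦ J x (β x)) x₀ = -J x₀ (torsion J α β x₀) := by
  simp only [torsion, hJ]
  rw [courantBracket_neg_right hJα hβ, courantBracket_neg_right hα hβ]
  simp only [map_add, map_sub, map_neg, hJ]
  abel

/-- The terms with `df(α)` and `df(Jα)` cancel because `J² = -1`. Only the anomalies of the four
brackets survive: two multiply `df` and two multiply `J df`. Skewness of `J` is not assumed; it will
be deduced from this formula. -/
lemma torsion_smul_right {f : M → ℝ} (hf : ContMDiffAt 𝓘(ℝ, E) 𝓘(ℝ, ℝ) ∞ f x₀)
    (hJ : ∀ x v, J x (J x v) = -v) (hα : SmoothSectionAt α x₀) (hβ : SmoothSectionAt β x₀)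
    (hJα : SmoothSectionAt (fun x ↦ J x (α x)) x₀) (hJβ : SmoothSectionAt (fun x ↦ J x (β x)) x₀) :
    torsion J α (fun x ↦ f x • β x) x₀ = f x₀ • torsion J α β x₀
      + ((1 / 2 : ℝ) * ((β x₀).2 (α x₀).1 + (α x₀).2 (β x₀).1)
        - (1 / 2 : ℝ) * ((J x₀ (β x₀)).2 (J x₀ (α x₀)).1 + (J x₀ (α x₀)).2 (J x₀ (β x₀)).1)) •
        ((0, dFun f x₀) : GenTangentSpace E x₀)
      + ((1 / 2 : ℝ) * ((β x₀).2 (J x₀ (α x₀)).1 + (J x₀ (α x₀)).2 (β x₀).1)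
        + (1 / 2 : ℝ) * ((J x₀ (β x₀)).2 (α x₀).1 + (α x₀).2 (J x₀ (β x₀)).1)) •
        J x₀ (0, dFun f x₀) := by
  simp only [torsion, map_smul]
  rw [courantBracket_smul_right hf hJα hJβ, courantBracket_smul_right hf hα hβ,
    courantBracket_smul_right hf hα hJβ, courantBracket_smul_right hf hJα hβ]
  simp only [map_add, map_sub, map_smul, hJ]
  module

end Torsion

end Torsion

/-! ### Torsion on covector fields as the exterior derivatives of `ω` and `ω_a`. -/

section GraphTorsion

variable {E : Type*} [NormedAddCommGroup E] [NormedSpace ℝ E]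
  {M : Type*} [TopologicalSpace M] [ChartedSpace E M] [IsManifold 𝓘(ℝ, E) ∞ M]

section Graph

variable {X Y : Π x : M, TangentSpace 𝓘(ℝ, E) x} {x₀ : M}

/-- The 1-form `dB(X, Y, ·)`, expressed by Courant brackets. -/
def contractDeriv (B : TwoForm E M) (X Y : Π x : M, TangentSpace 𝓘(ℝ, E) x) (x₀ : M) :
    CotangentSpace E x₀ :=
  (courantBracket (vecSection X) (covSection fun x ↦ B.toFun x (Y x)) x₀).2 +
    (courantBracket (covSection fun x ↦ B.toFun x (X x)) (vecSection Y) x₀).2 -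
    B.toFun x₀ (VectorField.mlieBracket 𝓘(ℝ, E) X Y x₀)

lemma contractDeriv_apply (B : TwoForm E M) (hX : SmoothSectionAt (vecSection X) x₀)
    (hY : SmoothSectionAt (vecSection Y) x₀) (w : TangentSpace 𝓘(ℝ, E) x₀) :
    contractDeriv B X Y x₀ w = mextDeriv B.toAlt x₀ ![X x₀, Y x₀, w] :=
  sub_eq_of_eq_add' (courantBracket_contract_snd hX hY B w)

lemma courantBracket_contract (B : TwoForm E M) (hX : SmoothSectionAt (vecSection X) x₀)
    (hY : SmoothSectionAt (vecSection Y) x₀) :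
    courantBracket (vecSection X) (covSection fun x ↦ B.toFun x (Y x)) x₀ +
      courantBracket (covSection fun x ↦ B.toFun x (X x)) (vecSection Y) x₀ =
    (0, B.toFun x₀ (VectorField.mlieBracket 𝓘(ℝ, E) X Y x₀) + contractDeriv B X Y x₀) := by
  refine Prod.ext ?_ ?_
  · rw [Prod.fst_add, courantBracket_contract_fst hX hY,
      courantBracket_swap hY (hX.contract B), Prod.fst_neg, courantBracket_contract_fst hY hX]
    simp
  · simp [contractDeriv]

variable {J : Π x : M, GenTangentSpace E x →L[ℝ] GenTangentSpace E x}
  {P : Π x : M, CotangentSpace E x →L[ℝ] TangentSpace 𝓘(ℝ, E) x}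
  {omega : TwoForm E M} {a : EndField E M}

/-- Since `J(i_Z ω) = Z - i_Z ω_a` and covector fields commute, only `[X, Y]` and the mixed brackets
for `ω` and `ω_a` remain. Applying `J` to `i_{[X,Y]} ω` returns `[X, Y] - i_{[X,Y]} ω_a`, which
cancels every term in `[X, Y]` and leaves the derivatives of the two forms. -/
lemma torsion_contract (h : omega.Commutes a) (hP : ∀ x v, P x (omega.toFun x v) = v)
    (hJ : ∀ x ξ, J x (0, ξ) = (P x ξ, -ξ.comp (a.toFun x)))
    (hX : SmoothSectionAt (vecSection X) x₀) (hY : SmoothSectionAt (vecSection Y) x₀) :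
    torsion J (covSection fun x ↦ omega.toFun x (X x)) (covSection fun x ↦ omega.toFun x (Y x)) x₀ =
      (-P x₀ (contractDeriv omega X Y x₀),
        (contractDeriv omega X Y x₀).comp (a.toFun x₀)
          - contractDeriv (omega.compEnd a h) X Y x₀) := by
  have hJc : ∀ Z : Π x : M, TangentSpace 𝓘(ℝ, E) x,
      (fun x ↦ J x (covSection (fun x ↦ omega.toFun x (Z x)) x)) =
        fun x ↦ vecSection Z x + -covSection (fun x ↦ (omega.compEnd a h).toFun x (Z x)) x := by
    intro Z
    funext x
    refine (hJ x _).trans ?_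
    rw [hP]
    refine Prod.ext ?_ (ContinuousLinearMap.ext fun v ↦ ?_)
    · simp [vecSection, covSection]
    · simp [vecSection, covSection]
      exact (h x _ _).symm
  have hθX := hX.contract (omega.compEnd a h)
  have hθY := hY.contract (omega.compEnd a h)
  have hωX := hX.contract omega
  have hωY := hY.contract omega
  have e1 := courantBracket_contract (omega.compEnd a h) hX hY
  have e2 := courantBracket_contract omega hX hY
  simp only [torsion, hJc]
  rw [courantBracket_add_right (hX.add hθX.neg) hY hθY.neg, courantBracket_add_left hY hX hθX.neg,
    courantBracket_add_left hθY.neg hX hθX.neg, courantBracket_neg_right hX hθY,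
    courantBracket_neg_right hθX.neg hθY, courantBracket_neg_left hθY hθX,
    courantBracket_neg_left hY hθX, courantBracket_add_left hωY hX hθX.neg,
    courantBracket_neg_left hωY hθX, courantBracket_add_right hωX hY hθY.neg,
    courantBracket_neg_right hωX hθY, courantBracket_covSection hωX hωY,
    courantBracket_covSection hθX hθY, courantBracket_covSection hωX hθY,
    courantBracket_covSection hθX hωY, courantBracket_vecSection hX hY]
  simp only [neg_zero, add_zero, sub_zero]
  have e3 : ∀ p A B : GenTangentSpace E x₀, p + -B + -A = p - (A + B) := by intros; abel
  rw [e2, hJ, e3, e1, map_add, hP]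
  refine Prod.ext ?_ (ContinuousLinearMap.ext fun v ↦ ?_)
  · simp
  · have h1 := h x₀ (VectorField.mlieBracket 𝓘(ℝ, E) X Y x₀) v
    simp [TwoForm.compEnd, h1]
    abel

end Graph

end GraphTorsion

/-! ### Smoothness of inverse and block bundle maps. -/

section BundleMaps

section Flat

variable {E : Type*} [NormedAddCommGroup E] [NormedSpace ℝ E]

lemma isInvertible_of_bijective [FiniteDimensional ℝ E] {P : (E →L[ℝ] ℝ) →L[ℝ] E}
    (hP : Function.Bijective P) : P.IsInvertible :=
  ⟨(LinearEquiv.ofBijective P.toLinearMap hP).toContinuousLinearEquiv, by ext; rfl⟩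

lemma isInvertible_of_injective [FiniteDimensional ℝ E] {B : E →L[ℝ] E →L[ℝ] ℝ}
    (hB : Function.Injective B) : B.IsInvertible := by
  have h : Module.finrank ℝ E = Module.finrank ℝ (E →L[ℝ] ℝ) := by
    rw [← (LinearMap.toContinuousLinearMap (𝕜 := ℝ) (E := E) (F' := ℝ)).finrank_eq]
    exact Subspace.dual_finrank_eq.symm
  exact ⟨(LinearEquiv.ofInjectiveOfFinrankEq B.toLinearMap hB h).toContinuousLinearEquiv,
    by ext; rfl⟩

end Flat

variable {E : Type*} [NormedAddCommGroup E] [NormedSpace ℝ E]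
  {M : Type*} [TopologicalSpace M] [ChartedSpace E M] [IsManifold 𝓘(ℝ, E) ∞ M]

/-- The expression of a bundle map `TM → T*M` in the trivialization at `x₀`. -/
def formCoord (B : Π x : M, TangentSpace 𝓘(ℝ, E) x →L[ℝ] CotangentSpace E x) (x₀ x : M) :
    E →L[ℝ] E →L[ℝ] ℝ :=
  (ContinuousLinearMap.precomp ℝ (ofCoord x₀ x)).comp ((B x).comp (ofCoord x₀ x))

/-- The expression of a bundle map `T*M → TM` in the trivialization at `x₀`. -/
def bivectorCoord (P : Π x : M, CotangentSpace E x →L[ℝ] TangentSpace 𝓘(ℝ, E) x) (x₀ x : M) :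
    (E →L[ℝ] ℝ) →L[ℝ] E :=
  (toCoord x₀ x).comp ((P x).comp (ContinuousLinearMap.precomp ℝ (toCoord x₀ x)))

section Inverse

variable {B : Π x : M, TangentSpace 𝓘(ℝ, E) x →L[ℝ] CotangentSpace E x}
  {P : Π x : M, CotangentSpace E x →L[ℝ] TangentSpace 𝓘(ℝ, E) x} {x₀ x : M}

lemma bivectorCoord_formCoord (h : ∀ v, P x (B x v) = v) (hx : x ∈ (chartAt E x₀).source) (v : E) :
    bivectorCoord P x₀ x (formCoord B x₀ x v) = v := by
  have h1 : ContinuousLinearMap.precomp ℝ (toCoord x₀ x) (formCoord B x₀ x v) =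
      B x (ofCoord x₀ x v) :=
    ContinuousLinearMap.ext fun w ↦ congrArg (B x (ofCoord x₀ x v)) (ofCoord_toCoord hx w)
  have h2 : bivectorCoord P x₀ x (formCoord B x₀ x v) = toCoord x₀ x (P x
    (ContinuousLinearMap.precomp ℝ (toCoord x₀ x) (formCoord B x₀ x v))) := rfl
  rw [h2, h1, h]
  exact toCoord_ofCoord hx v

lemma formCoord_bivectorCoord (h : ∀ ξ, B x (P x ξ) = ξ) (hx : x ∈ (chartAt E x₀).source)
    (ξ : E →L[ℝ] ℝ) : formCoord B x₀ x (bivectorCoord P x₀ x ξ) = ξ := by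
  refine ContinuousLinearMap.ext fun w ↦ ?_
  have h1 : formCoord B x₀ x (bivectorCoord P x₀ x ξ) w = B x (ofCoord x₀ x (toCoord x₀ x (P x
    (ContinuousLinearMap.precomp ℝ (toCoord x₀ x) ξ)))) (ofCoord x₀ x w) := rfl
  rw [h1, ofCoord_toCoord hx, h]
  exact congrArg ξ (toCoord_ofCoord hx w)

/-- A bundle map `TM → T*M` is smooth if its inverse is. -/
lemma contMDiffAt_formCoord (h1 : ∀ x v, P x (B x v) = v) (h2 : ∀ x ξ, B x (P x ξ) = ξ)
    (hP : ContMDiffAt 𝓘(ℝ, E) 𝓘(ℝ, (E →L[ℝ] ℝ) →L[ℝ] E) ∞ (bivectorCoord P x₀) x₀) :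
    ContMDiffAt 𝓘(ℝ, E) 𝓘(ℝ, E →L[ℝ] E →L[ℝ] ℝ) ∞ (formCoord B x₀) x₀ := by
  have key : ∀ x ∈ (chartAt E x₀).source, (bivectorCoord P x₀ x).inverse = formCoord B x₀ x :=
    fun x hx ↦ ContinuousLinearMap.inverse_eq
      (ContinuousLinearMap.ext (bivectorCoord_formCoord (h1 x) hx))
      (ContinuousLinearMap.ext (formCoord_bivectorCoord (h2 x) hx))
  have hx₀ := mem_chart_source E x₀
  have h3 : ContDiffAt ℝ ∞ ContinuousLinearMap.inverse (bivectorCoord P x₀ x₀) :=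
    contDiffAt_map_inverse (ContinuousLinearEquiv.equivOfInverse (bivectorCoord P x₀ x₀)
      (formCoord B x₀ x₀) (formCoord_bivectorCoord (h2 x₀) hx₀)
      (bivectorCoord_formCoord (h1 x₀) hx₀))
  refine (h3.contMDiffAt.comp x₀ hP).congr_of_eventuallyEq ?_
  filter_upwards [(chartAt E x₀).open_source.mem_nhds hx₀] with x hx
  exact (key x hx).symm

/-- A bundle map `T*M → TM` is smooth if its inverse is. -/
lemma contMDiffAt_bivectorCoord [CompleteSpace E]
    (h1 : ∀ x v, P x (B x v) = v) (h2 : ∀ x ξ, B x (P x ξ) = ξ)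
    (hB : ContMDiffAt 𝓘(ℝ, E) 𝓘(ℝ, E →L[ℝ] E →L[ℝ] ℝ) ∞ (formCoord B x₀) x₀) :
    ContMDiffAt 𝓘(ℝ, E) 𝓘(ℝ, (E →L[ℝ] ℝ) →L[ℝ] E) ∞ (bivectorCoord P x₀) x₀ := by
  have key : ∀ x ∈ (chartAt E x₀).source, (formCoord B x₀ x).inverse = bivectorCoord P x₀ x :=
    fun x hx ↦ ContinuousLinearMap.inverse_eq
      (ContinuousLinearMap.ext (formCoord_bivectorCoord (h2 x) hx))
      (ContinuousLinearMap.ext (bivectorCoord_formCoord (h1 x) hx))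
  have hx₀ := mem_chart_source E x₀
  -- Inversion is smooth at an isomorphism with complete domain. The domain is now `E`, whereas for
  -- the opposite inverse it was the dual, which is always complete.
  have h3 : ContDiffAt ℝ ∞ ContinuousLinearMap.inverse (formCoord B x₀ x₀) :=
    contDiffAt_map_inverse (ContinuousLinearEquiv.equivOfInverse (formCoord B x₀ x₀)
      (bivectorCoord P x₀ x₀) (bivectorCoord_formCoord (h1 x₀) hx₀)
      (formCoord_bivectorCoord (h2 x₀) hx₀))
  refine (h3.contMDiffAt.comp x₀ hB).congr_of_eventuallyEq ?_
  filter_upwards [(chartAt E x₀).open_source.mem_nhds hx₀] with x hx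
  exact (key x hx).symm

end Inverse

section Endomorphism

variable {J : Π x : M, GenTangentSpace E x →L[ℝ] GenTangentSpace E x} {x₀ : M}

/-- The expression of an endomorphism of `TM ⊕ T*M` in the trivialization at `x₀`. -/
def genEndCoord (J : Π x : M, GenTangentSpace E x →L[ℝ] GenTangentSpace E x) (x₀ x : M) :
    E × (E →L[ℝ] ℝ) →L[ℝ] E × (E →L[ℝ] ℝ) :=
  (toCoordGen x₀ x).comp ((J x).comp (ofCoordGen x₀ x))

lemma SmoothSectionAt.apply {α : Π x : M, GenTangentSpace E x}
    (hJ : ContMDiffAt 𝓘(ℝ, E) 𝓘(ℝ, E × (E →L[ℝ] ℝ) →L[ℝ] E × (E →L[ℝ] ℝ)) ∞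
      (genEndCoord J x₀) x₀) (hα : SmoothSectionAt α x₀) :
    SmoothSectionAt (fun x ↦ J x (α x)) x₀ := by
  refine (hJ.clm_apply hα).congr_of_eventuallyEq ?_
  filter_upwards [(chartAt E x₀).open_source.mem_nhds (mem_chart_source E x₀)] with x hx
  exact congrArg (fun w ↦ toCoordGen x₀ x (J x w)) (ofCoordGen_toCoordGen hx (α x)).symm

lemma contMDiffAt_vec_component
    (hJ : ContMDiffAt 𝓘(ℝ, E) 𝓘(ℝ, E × (E →L[ℝ] ℝ) →L[ℝ] E × (E →L[ℝ] ℝ)) ∞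
      (genEndCoord J x₀) x₀) :
    ContMDiffAt 𝓘(ℝ, E) 𝓘(ℝ, E →L[ℝ] E) ∞ (fun x ↦ (toCoord x₀ x).comp
      (((ContinuousLinearMap.fst ℝ (TangentSpace 𝓘(ℝ, E) x) (CotangentSpace E x)).comp
        ((J x).comp (ContinuousLinearMap.inl ℝ (TangentSpace 𝓘(ℝ, E) x)
          (CotangentSpace E x)))).comp (ofCoord x₀ x))) x₀ := by
  refine ((contMDiffAt_const (c := ContinuousLinearMap.fst ℝ E (E →L[ℝ] ℝ))).clm_comp
    (hJ.clm_comp (contMDiffAt_const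
      (c := ContinuousLinearMap.inl ℝ E (E →L[ℝ] ℝ))))).congr_of_eventuallyEq
      (.of_forall fun x ↦ ContinuousLinearMap.ext fun v ↦ ?_)
  exact congrArg (fun ξ ↦ toCoord x₀ x (J x (ofCoord x₀ x v, ξ)).1)
    (map_zero (ContinuousLinearMap.precomp ℝ (toCoord x₀ x))).symm

lemma contMDiffAt_bivector_component
    (hJ : ContMDiffAt 𝓘(ℝ, E) 𝓘(ℝ, E × (E →L[ℝ] ℝ) →L[ℝ] E × (E →L[ℝ] ℝ)) ∞
      (genEndCoord J x₀) x₀) :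
    ContMDiffAt 𝓘(ℝ, E) 𝓘(ℝ, (E →L[ℝ] ℝ) →L[ℝ] E) ∞ (bivectorCoord (fun x ↦
      (ContinuousLinearMap.fst ℝ (TangentSpace 𝓘(ℝ, E) x) (CotangentSpace E x)).comp
        ((J x).comp (ContinuousLinearMap.inr ℝ (TangentSpace 𝓘(ℝ, E) x)
          (CotangentSpace E x)))) x₀) x₀ := by
  refine ((contMDiffAt_const (c := ContinuousLinearMap.fst ℝ E (E →L[ℝ] ℝ))).clm_comp
    (hJ.clm_comp (contMDiffAt_const
      (c := ContinuousLinearMap.inr ℝ E (E →L[ℝ] ℝ))))).congr_of_eventuallyEq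
      (.of_forall fun x ↦ ContinuousLinearMap.ext fun ξ ↦ ?_)
  exact congrArg (fun v ↦ toCoord x₀ x
    (J x (v, ContinuousLinearMap.precomp ℝ (toCoord x₀ x) ξ)).1) (map_zero (ofCoord x₀ x)).symm

/-- The endomorphism of `TM ⊕ T*M` with components `a`, `P`, `S` and `-a*`. -/
def blockEnd (a : Π x : M, TangentSpace 𝓘(ℝ, E) x →L[ℝ] TangentSpace 𝓘(ℝ, E) x)
    (P : Π x : M, CotangentSpace E x →L[ℝ] TangentSpace 𝓘(ℝ, E) x)
    (S : Π x : M, TangentSpace 𝓘(ℝ, E) x →L[ℝ] CotangentSpace E x) (x : M) :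
    GenTangentSpace E x →L[ℝ] GenTangentSpace E x :=
  ((a x).coprod (P x)).prod ((S x).coprod (-ContinuousLinearMap.precomp ℝ (a x)))

lemma contMDiffAt_blockEnd {a : Π x : M, TangentSpace 𝓘(ℝ, E) x →L[ℝ] TangentSpace 𝓘(ℝ, E) x}
    {P : Π x : M, CotangentSpace E x →L[ℝ] TangentSpace 𝓘(ℝ, E) x}
    {S : Π x : M, TangentSpace 𝓘(ℝ, E) x →L[ℝ] CotangentSpace E x}
    (ha : ContMDiffAt 𝓘(ℝ, E) 𝓘(ℝ, E →L[ℝ] E) ∞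
      (fun x ↦ (toCoord x₀ x).comp ((a x).comp (ofCoord x₀ x))) x₀)
    (hP : ContMDiffAt 𝓘(ℝ, E) 𝓘(ℝ, (E →L[ℝ] ℝ) →L[ℝ] E) ∞ (bivectorCoord P x₀) x₀)
    (hS : ContMDiffAt 𝓘(ℝ, E) 𝓘(ℝ, E →L[ℝ] E →L[ℝ] ℝ) ∞ (formCoord S x₀) x₀) :
    ContMDiffAt 𝓘(ℝ, E) 𝓘(ℝ, E × (E →L[ℝ] ℝ) →L[ℝ] E × (E →L[ℝ] ℝ)) ∞
      (genEndCoord (blockEnd a P S) x₀) x₀ := by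
  have hfst : ContMDiffAt 𝓘(ℝ, E) 𝓘(ℝ, E × (E →L[ℝ] ℝ) →L[ℝ] E) ∞
      (fun _ : M ↦ ContinuousLinearMap.fst ℝ E (E →L[ℝ] ℝ)) x₀ := contMDiffAt_const
  have hsnd : ContMDiffAt 𝓘(ℝ, E) 𝓘(ℝ, E × (E →L[ℝ] ℝ) →L[ℝ] E →L[ℝ] ℝ) ∞
      (fun _ : M ↦ ContinuousLinearMap.snd ℝ E (E →L[ℝ] ℝ)) x₀ := contMDiffAt_const
  have hinl : ContMDiffAt 𝓘(ℝ, E) 𝓘(ℝ, E →L[ℝ] E × (E →L[ℝ] ℝ)) ∞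
      (fun _ : M ↦ ContinuousLinearMap.inl ℝ E (E →L[ℝ] ℝ)) x₀ := contMDiffAt_const
  have hinr : ContMDiffAt 𝓘(ℝ, E) 𝓘(ℝ, (E →L[ℝ] ℝ) →L[ℝ] E × (E →L[ℝ] ℝ)) ∞
      (fun _ : M ↦ ContinuousLinearMap.inr ℝ E (E →L[ℝ] ℝ)) x₀ := contMDiffAt_const
  have ha' := ha.clm_precomp (F₃ := ℝ)
  refine ((hinl.clm_comp ((ha.clm_comp hfst).add (hP.clm_comp hsnd))).add
    (hinr.clm_comp ((hS.clm_comp hfst).sub (ha'.clm_comp hsnd)))).congr_of_eventuallyEq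
    (.of_forall fun x ↦ ContinuousLinearMap.ext fun w ↦ ?_)
  refine Prod.ext ?_ (ContinuousLinearMap.ext fun v ↦ ?_)
  · simp [genEndCoord, toCoordGen, ofCoordGen, blockEnd, bivectorCoord]
  · simp [genEndCoord, toCoordGen, ofCoordGen, blockEnd, formCoord]
    exact (sub_eq_add_neg _ _).symm

end Endomorphism

end BundleMaps

/-! ### Components and skewness of a non-degenerate structure. -/

section StructureComponents

variable {E : Type*} [NormedAddCommGroup E] [NormedSpace ℝ E]
  {M : Type*} [TopologicalSpace M] [ChartedSpace E M] [IsManifold 𝓘(ℝ, E) ∞ M]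

lemma TwoForm.isClosed_of_contractDeriv_eq_zero [FiniteDimensional ℝ E] [T2Space M]
    {B : TwoForm E M}
    (h : ∀ (X Y : Π x : M, TangentSpace 𝓘(ℝ, E) x) (x : M), IsSmoothSection (vecSection X) →
      IsSmoothSection (vecSection Y) → contractDeriv B X Y x = 0) : B.IsClosed := by
  intro x
  have key : ∀ u v w : TangentSpace 𝓘(ℝ, E) x, mextDeriv B.toAlt x ![u, v, w] = 0 := by
    intro u v w
    obtain ⟨α, hα, rfl⟩ : ∃ α : Π x : M, GenTangentSpace E x, IsSmoothSection α ∧ (α x).1 = u := by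
      obtain ⟨α, hα, h⟩ := exists_isSmoothSection_eq x ((u, 0) : GenTangentSpace E x)
      exact ⟨α, hα, by rw [h]⟩
    obtain ⟨β, hβ, rfl⟩ : ∃ α : Π x : M, GenTangentSpace E x, IsSmoothSection α ∧ (α x).1 = v := by
      obtain ⟨α, hα, h⟩ := exists_isSmoothSection_eq x ((v, 0) : GenTangentSpace E x)
      exact ⟨α, hα, by rw [h]⟩
    have hX := fun y ↦ (isSmoothSection_iff.1 hα y).vecSection_fst
    have hY := fun y ↦ (isSmoothSection_iff.1 hβ y).vecSection_fst
    refine (contractDeriv_apply B (hX x) (hY x) w).symm.trans ?_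
    rw [h _ _ x (isSmoothSection_iff.2 hX) (isSmoothSection_iff.2 hY)]
    rfl
  refine ContinuousAlternatingMap.ext fun m ↦ ?_
  have hm : m = ![m 0, m 1, m 2] := by
    funext i; fin_cases i <;> rfl
  rw [hm]
  exact key _ _ _

section Flat

lemma apply_inverse_of_bijective [FiniteDimensional ℝ E] {P : (E →L[ℝ] ℝ) →L[ℝ] E}
    (hP : Function.Bijective P) (v : E) : P (P.inverse v) = v :=
  DFunLike.congr_fun (isInvertible_of_bijective hP).self_comp_inverse v

lemma inverse_apply_of_bijective [FiniteDimensional ℝ E] {P : (E →L[ℝ] ℝ) →L[ℝ] E}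
    (hP : Function.Bijective P) (ξ : E →L[ℝ] ℝ) : P.inverse (P ξ) = ξ :=
  DFunLike.congr_fun (isInvertible_of_bijective hP).inverse_comp_self ξ

lemma apply_inverse_of_injective [FiniteDimensional ℝ E] {B : E →L[ℝ] E →L[ℝ] ℝ}
    (hB : Function.Injective B) (ξ : E →L[ℝ] ℝ) : B (B.inverse ξ) = ξ :=
  DFunLike.congr_fun (isInvertible_of_injective hB).self_comp_inverse ξ

lemma inverse_apply_of_injective [FiniteDimensional ℝ E] {B : E →L[ℝ] E →L[ℝ] ℝ}
    (hB : Function.Injective B) (v : E) : B.inverse (B v) = v :=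
  DFunLike.congr_fun (isInvertible_of_injective hB).inverse_comp_self v

end Flat

namespace GenComplexStructure

variable (J : GenComplexStructure E M)

lemma piSharp_apply (x : M) (ξ : CotangentSpace E x) : J.piSharp x ξ = (J.toFun x (0, ξ)).1 := rfl

lemma contMDiffAt_genEndCoord (x₀ : M) :
    ContMDiffAt 𝓘(ℝ, E) 𝓘(ℝ, E × (E →L[ℝ] ℝ) →L[ℝ] E × (E →L[ℝ] ℝ)) ∞
      (genEndCoord J.toFun x₀) x₀ :=
  contMDiffAt_genEnd_iff.1 (J.smooth x₀)

/-- The component `a : TM → TM` of a generalized complex structure. -/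
def endField : EndField E M where
  toFun x := (ContinuousLinearMap.fst ℝ (TangentSpace 𝓘(ℝ, E) x) (CotangentSpace E x)).comp
    ((J.toFun x).comp
      (ContinuousLinearMap.inl ℝ (TangentSpace 𝓘(ℝ, E) x) (CotangentSpace E x)))
  smooth x₀ := contMDiffAt_endField_iff.2
    (contMDiffAt_vec_component (J.contMDiffAt_genEndCoord x₀))

lemma endField_apply (x : M) (v : TangentSpace 𝓘(ℝ, E) x) :
    J.endField.toFun x v = (J.toFun x (v, 0)).1 := rfl

variable [FiniteDimensional ℝ E]

section Skew

variable [T2Space M] {J}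

/-- A non-degenerate generalized complex structure is skew for the pairing of `TM ⊕ T*M`. -/
lemma IsNondegenerate.skew (hJ : J.IsNondegenerate) (x : M) (u v : GenTangentSpace E x) :
    v.2 (J.toFun x u).1 + (J.toFun x u).2 v.1 +
      ((J.toFun x v).2 u.1 + u.2 (J.toFun x v).1) = 0 := by
  obtain ⟨α, hα, rfl⟩ := exists_isSmoothSection_eq x u
  obtain ⟨β, hβ, rfl⟩ := exists_isSmoothSection_eq x v
  have hαx := isSmoothSection_iff.1 hα x
  have hβx := isSmoothSection_iff.1 hβ x
  by_contra hc
  -- If the pairing is nonzero, comparing the torsions of `(α, β)` and `(α, fβ)` makes a combination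
  -- of `df` and `J df` vanish, the latter with nonzero coefficient. Its vector component is a
  -- nonzero multiple of `π♯ df`, so `df = 0`. Every covector at `x` is such a `df`, hence zero, and
  -- then so is the pairing.
  have hzero : ∀ ξ : CotangentSpace E x, ξ = 0 := by
    intro ξ
    obtain ⟨f, hf, rfl⟩ := exists_dFun_eq x ξ
    have hfβ : IsSmoothSection fun y ↦ f y • β y :=
      isSmoothSection_iff.2 fun y ↦ (isSmoothSection_iff.1 hβ y).smul (hf y)
    have h0 : torsion J.toFun α β x = 0 := J.torsion_free α β hα hβ x
    have h1 : torsion J.toFun α (fun y ↦ f y • β y) x = 0 := J.torsion_free α _ hα hfβ x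
    rw [torsion_smul_right (hf x) J.sq_eq_neg hαx hβx
      (hαx.apply (J.contMDiffAt_genEndCoord x)) (hβx.apply (J.contMDiffAt_genEndCoord x)), h0] at h1
    have h2 := congrArg Prod.fst h1
    simp only [smul_zero, zero_add, Prod.fst_add, Prod.smul_fst, Prod.fst_zero] at h2
    rw [← mul_add] at h2
    have h3 : J.piSharp x (dFun f x) = 0 :=
      (smul_eq_zero.1 h2).resolve_left (mul_ne_zero (by norm_num) hc)
    exact (hJ x).1 (h3.trans (map_zero _).symm)
  refine hc ?_
  rw [hzero (β x).2, hzero (J.toFun x (α x)).2, hzero (J.toFun x (β x)).2, hzero (α x).2]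
  simp

lemma IsNondegenerate.piSharp_skew (hJ : J.IsNondegenerate) (x : M) (ξ η : CotangentSpace E x) :
    η (J.piSharp x ξ) = -ξ (J.piSharp x η) := by
  have h := hJ.skew x (0, ξ) (0, η)
  simp only [map_zero, add_zero, zero_add] at h
  exact eq_neg_of_add_eq_zero_left h

lemma IsNondegenerate.apply_inr_snd (hJ : J.IsNondegenerate) (x : M) (ξ : CotangentSpace E x) :
    (J.toFun x (0, ξ)).2 = -ξ.comp (J.endField.toFun x) := by
  refine ContinuousLinearMap.ext fun v ↦ ?_
  have h := hJ.skew x (0, ξ) (v, 0)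
  simp only [map_zero, zero_add, zero_apply] at h
  exact eq_neg_of_add_eq_zero_left h

lemma IsNondegenerate.apply_inr (hJ : J.IsNondegenerate) (x : M) (ξ : CotangentSpace E x) :
    J.toFun x (0, ξ) = (J.piSharp x ξ, -ξ.comp (J.endField.toFun x)) :=
  Prod.ext rfl (hJ.apply_inr_snd x ξ)

end Skew

end GenComplexStructure

end StructureComponents

/-! ### From a non-degenerate structure to a Hitchin pair. -/

section FromGenComplex

variable {E : Type*} [NormedAddCommGroup E] [NormedSpace ℝ E]
  {M : Type*} [TopologicalSpace M] [ChartedSpace E M] [IsManifold 𝓘(ℝ, E) ∞ M]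

namespace GenComplexStructure

/-- The inverse of a bijective `π♯`, as a bundle map `TM → T*M`. -/
def sharpInverse (J : GenComplexStructure E M) (x : M) :
    TangentSpace 𝓘(ℝ, E) x →L[ℝ] CotangentSpace E x :=
  show E →L[ℝ] E →L[ℝ] ℝ from
    ContinuousLinearMap.inverse (show (E →L[ℝ] ℝ) →L[ℝ] E from J.piSharp x)

namespace IsNondegenerate

variable [FiniteDimensional ℝ E] {J : GenComplexStructure E M}

lemma piSharp_sharpInverse (hJ : J.IsNondegenerate) (x : M) (v : TangentSpace 𝓘(ℝ, E) x) :
    J.piSharp x (sharpInverse J x v) = v :=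
  apply_inverse_of_bijective (E := E) (hJ x) v

lemma sharpInverse_piSharp (hJ : J.IsNondegenerate) (x : M) (ξ : CotangentSpace E x) :
    sharpInverse J x (J.piSharp x ξ) = ξ :=
  inverse_apply_of_bijective (E := E) (hJ x) ξ

variable [T2Space M]

/-- The 2-form whose `ω_♯` is the inverse of `π♯`. -/
def form (hJ : J.IsNondegenerate) : TwoForm E M where
  toFun := sharpInverse J
  smooth x₀ := contMDiffAt_form_iff.2 (contMDiffAt_formCoord hJ.piSharp_sharpInverse
    hJ.sharpInverse_piSharp (contMDiffAt_bivector_component (J.contMDiffAt_genEndCoord x₀)))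
  alternating x v := by
    have h := hJ.piSharp_skew x (sharpInverse J x v) (sharpInverse J x v)
    rw [hJ.piSharp_sharpInverse] at h
    linarith

lemma piSharp_form (hJ : J.IsNondegenerate) (x : M) (v : TangentSpace 𝓘(ℝ, E) x) :
    J.piSharp x (hJ.form.toFun x v) = v := hJ.piSharp_sharpInverse x v

lemma form_piSharp (hJ : J.IsNondegenerate) (x : M) (ξ : CotangentSpace E x) :
    hJ.form.toFun x (J.piSharp x ξ) = ξ := hJ.sharpInverse_piSharp x ξ

/-- This is the vector component of `J²(0, ξ) = -(0, ξ)`. -/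
lemma endField_piSharp (hJ : J.IsNondegenerate) (x : M) (ξ : CotangentSpace E x) :
    J.endField.toFun x (J.piSharp x ξ) = J.piSharp x (ξ.comp (J.endField.toFun x)) := by
  have h1 := congrArg Prod.fst (J.sq_eq_neg x (0, ξ))
  have h2 : ((J.piSharp x ξ, -ξ.comp (J.endField.toFun x)) : GenTangentSpace E x) =
      (J.piSharp x ξ, 0) + (0, -ξ.comp (J.endField.toFun x)) := by simp
  rw [hJ.apply_inr, h2, map_add, Prod.fst_add, ← endField_apply, ← piSharp_apply, map_neg] at h1
  simpa using add_neg_eq_zero.1 (h1.trans (by simp))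

lemma form_commutes (hJ : J.IsNondegenerate) : hJ.form.Commutes J.endField := by
  intro x u v
  have h : J.endField.toFun x u = J.piSharp x ((hJ.form.toFun x u).comp (J.endField.toFun x)) := by
    rw [← hJ.endField_piSharp, hJ.piSharp_form]
  rw [h, hJ.form_piSharp]
  rfl

/-- With `v = π♯ ξ`, the covector component of `J²(0, ξ) = -(0, ξ)` reads `σ_♯ v + ξ ∘ a ∘ a = -ξ`.
Surjectivity of `π♯` thus determines the lower left block. -/
lemma apply_inl_snd (hJ : J.IsNondegenerate) (x : M) (v : TangentSpace 𝓘(ℝ, E) x) :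
    (J.toFun x (v, 0)).2 = -(hJ.form.toFun x v +
      ((hJ.form.toFun x v).comp (J.endField.toFun x)).comp (J.endField.toFun x)) := by
  obtain ⟨ξ, hξ⟩ : ∃ ξ, ξ = hJ.form.toFun x v := ⟨_, rfl⟩
  have hv : v = J.piSharp x ξ := by rw [hξ, hJ.piSharp_form]
  have h1 := congrArg Prod.snd (J.sq_eq_neg x (0, ξ))
  have h2 : ((J.piSharp x ξ, -ξ.comp (J.endField.toFun x)) : GenTangentSpace E x) =
      (J.piSharp x ξ, 0) + (0, -ξ.comp (J.endField.toFun x)) := by simp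
  rw [hJ.apply_inr, h2, map_add, Prod.snd_add, hJ.apply_inr_snd, ← hv] at h1
  rw [← hξ]
  refine (eq_sub_of_add_eq h1).trans ?_
  refine ContinuousLinearMap.ext fun w ↦ ?_
  simp
  abel

/-- In `torsion_contract` the vector component kills `dω`, as `π♯` is injective; the covector
component then reduces to `dω_a`. -/
lemma contractDeriv_eq_zero (hJ : J.IsNondegenerate) {X Y : Π x : M, TangentSpace 𝓘(ℝ, E) x}
    (hX : IsSmoothSection (vecSection X)) (hY : IsSmoothSection (vecSection Y)) (x : M) :
    contractDeriv hJ.form X Y x = 0 ∧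
      contractDeriv (hJ.form.compEnd J.endField hJ.form_commutes) X Y x = 0 := by
  have hX' := isSmoothSection_iff.1 hX
  have hY' := isSmoothSection_iff.1 hY
  have h := torsion_contract hJ.form_commutes hJ.piSharp_form hJ.apply_inr (hX' x) (hY' x)
  have h0 : torsion J.toFun _ _ x = 0 := J.torsion_free _ _
    (isSmoothSection_iff.2 fun y ↦ (hX' y).contract hJ.form)
    (isSmoothSection_iff.2 fun y ↦ (hY' y).contract hJ.form) x
  rw [h0] at h
  have h1 : contractDeriv hJ.form X Y x = 0 := (hJ x).1
    ((neg_eq_zero.1 (congrArg Prod.fst h).symm).trans (map_zero _).symm)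
  refine ⟨h1, ?_⟩
  have h2 := congrArg Prod.snd h
  rw [h1] at h2
  simpa using h2.symm

/-- The Hitchin pair of a non-degenerate generalized complex structure. -/
def hitchinPair (hJ : J.IsNondegenerate) : HitchinPair E M where
  omega := hJ.form
  a := J.endField
  symplectic := by
    refine ⟨TwoForm.isClosed_of_contractDeriv_eq_zero fun X Y x hX hY ↦
      (hJ.contractDeriv_eq_zero hX hY x).1, fun x u hu ↦ ?_⟩
    have h : hJ.form.toFun x u = 0 := ContinuousLinearMap.ext hu
    rw [← hJ.piSharp_form x u, h, map_zero]
  commutes := hJ.form_commutes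
  closed := TwoForm.isClosed_of_contractDeriv_eq_zero fun X Y x hX hY ↦
      (hJ.contractDeriv_eq_zero hX hY x).2

lemma apply_eq (hJ : J.IsNondegenerate) (x : M) (v : TangentSpace 𝓘(ℝ, E) x)
    (ξ : CotangentSpace E x) :
    J.toFun x (v, ξ) = (hJ.hitchinPair.a.toFun x v + J.piSharp x ξ,
      hJ.hitchinPair.twist.toFun x v - ξ.comp (hJ.hitchinPair.a.toFun x)) := by
  have h : ((v, ξ) : GenTangentSpace E x) = (v, 0) + (0, ξ) := by simp
  rw [h, map_add, hJ.apply_inr]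
  refine Prod.ext rfl ?_
  rw [Prod.snd_add, hJ.apply_inl_snd, sub_eq_add_neg]
  refine congrArg (· + -ξ.comp (J.endField.toFun x)) ?_
  refine ContinuousLinearMap.ext fun w ↦ ?_
  have h1 := hJ.form_commutes x v (J.endField.toFun x w)
  simp [HitchinPair.twist, HitchinPair.pullback_apply, hitchinPair, h1]

end IsNondegenerate

end GenComplexStructure

end FromGenComplex

/-! ### From a Hitchin pair to a generalized complex structure. -/

section FromHitchinPair

variable {E : Type*} [NormedAddCommGroup E] [NormedSpace ℝ E]
  {M : Type*} [TopologicalSpace M] [ChartedSpace E M] [IsManifold 𝓘(ℝ, E) ∞ M]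

namespace HitchinPair

variable (p : HitchinPair E M)

/-- The inverse of `ω_♯`, as a bundle map `T*M → TM`. -/
def bivector (x : M) : CotangentSpace E x →L[ℝ] TangentSpace 𝓘(ℝ, E) x :=
  show (E →L[ℝ] ℝ) →L[ℝ] E from
    ContinuousLinearMap.inverse (show E →L[ℝ] E →L[ℝ] ℝ from p.omega.toFun x)

/-- The endomorphism of `TM ⊕ T*M` of a Hitchin pair. -/
def genEnd (x : M) : GenTangentSpace E x →L[ℝ] GenTangentSpace E x :=
  blockEnd p.a.toFun p.bivector p.twist.toFun x

lemma genEnd_apply (x : M) (v : TangentSpace 𝓘(ℝ, E) x) (ξ : CotangentSpace E x) :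
    p.genEnd x (v, ξ) = (p.a.toFun x v + p.bivector x ξ,
      p.twist.toFun x v - ξ.comp (p.a.toFun x)) :=
  Prod.ext rfl (sub_eq_add_neg _ _).symm

lemma genEnd_inr (x : M) (ξ : CotangentSpace E x) :
    p.genEnd x (0, ξ) = (p.bivector x ξ, -ξ.comp (p.a.toFun x)) := by
  rw [genEnd_apply, map_zero, map_zero, zero_add, zero_sub]

lemma twist_apply (x : M) (v : TangentSpace 𝓘(ℝ, E) x) :
    p.twist.toFun x v =
      -(p.omega.toFun x v + p.omega.toFun x (p.a.toFun x (p.a.toFun x v))) := by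
  have h : p.twist.toFun x v = -(p.omega.toFun x v + p.pullback x v) := rfl
  rw [h, pullback_eq]
  rfl

lemma omega_endField (x : M) (v : TangentSpace 𝓘(ℝ, E) x) :
    p.omega.toFun x (p.a.toFun x v) = (p.omega.toFun x v).comp (p.a.toFun x) :=
  ContinuousLinearMap.ext (p.commutes x v)

lemma injective_omega (x : M) : Function.Injective (p.omega.toFun x) :=
  (injective_iff_map_eq_zero _).2 fun u hu ↦ p.symplectic.2 x u fun v ↦ by rw [hu]; rfl

variable [FiniteDimensional ℝ E]

lemma bivector_omega (x : M) (v : TangentSpace 𝓘(ℝ, E) x) :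
    p.bivector x (p.omega.toFun x v) = v :=
  inverse_apply_of_injective (E := E) (p.injective_omega x) v

lemma omega_bivector (x : M) (ξ : CotangentSpace E x) :
    p.omega.toFun x (p.bivector x ξ) = ξ :=
  apply_inverse_of_injective (E := E) (p.injective_omega x) ξ

/-- Identifying `T*M` with `TM` through `ω_♯`, which intertwines `a` and `a*`, the endomorphism
becomes the matrix with rows `(a, 1)` and `(-(1 + a²), -a)`, whose square is `-1`. -/
lemma genEnd_genEnd (x : M) (w : GenTangentSpace E x) : p.genEnd x (p.genEnd x w) = -w := by
  obtain ⟨v, ξ⟩ := w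
  obtain ⟨u, rfl⟩ : ∃ u, ξ = p.omega.toFun x u := ⟨_, (p.omega_bivector x ξ).symm⟩
  rw [genEnd_apply, genEnd_apply, p.bivector_omega, ← p.omega_endField]
  have h1 : ∀ w, (p.twist.toFun x w).comp (p.a.toFun x) = p.twist.toFun x (p.a.toFun x w) := by
    intro w
    rw [p.twist_apply, p.twist_apply, ContinuousLinearMap.neg_comp, ContinuousLinearMap.add_comp,
      p.omega_endField x w, p.omega_endField x (p.a.toFun x (p.a.toFun x w))]
  refine Prod.ext ?_ ?_
  · dsimp only
    rw [map_sub, p.bivector_omega, p.twist_apply, map_neg, map_add, map_add, p.bivector_omega,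
      p.bivector_omega]
    simp
  · dsimp only
    rw [ContinuousLinearMap.sub_comp, h1, ← p.omega_endField, map_add, p.twist_apply x u]
    simp

lemma contMDiffAt_genEndCoord (x₀ : M) :
    ContMDiffAt 𝓘(ℝ, E) 𝓘(ℝ, E × (E →L[ℝ] ℝ) →L[ℝ] E × (E →L[ℝ] ℝ)) ∞
      (genEndCoord p.genEnd x₀) x₀ := by
  have : CompleteSpace E := FiniteDimensional.complete ℝ E
  exact contMDiffAt_blockEnd (contMDiffAt_endField_iff.1 (p.a.smooth x₀))
    (contMDiffAt_bivectorCoord p.bivector_omega p.omega_bivector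
      (contMDiffAt_form_iff.1 (p.omega.smooth x₀))) (contMDiffAt_form_iff.1 (p.twist.smooth x₀))

end HitchinPair

lemma contractDeriv_eq_zero_of_isClosed {B : TwoForm E M} (hB : B.IsClosed)
    {X Y : Π x : M, TangentSpace 𝓘(ℝ, E) x} {x : M} (hX : SmoothSectionAt (vecSection X) x)
    (hY : SmoothSectionAt (vecSection Y) x) : contractDeriv B X Y x = 0 := by
  refine ContinuousLinearMap.ext fun w ↦ ?_
  rw [contractDeriv_apply B hX hY, hB x]
  rfl

namespace HitchinPair

variable [FiniteDimensional ℝ E] (p : HitchinPair E M) {X Y : Π x : M, TangentSpace 𝓘(ℝ, E) x}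
  {x₀ : M} {α β : Π x : M, GenTangentSpace E x}

lemma torsion_omega_eq_zero (hX : SmoothSectionAt (vecSection X) x₀)
    (hY : SmoothSectionAt (vecSection Y) x₀) :
    torsion p.genEnd (covSection fun x ↦ p.omega.toFun x (X x))
      (covSection fun x ↦ p.omega.toFun x (Y x)) x₀ = 0 := by
  rw [torsion_contract p.commutes p.bivector_omega p.genEnd_inr hX hY,
    contractDeriv_eq_zero_of_isClosed p.symplectic.1 hX hY,
    contractDeriv_eq_zero_of_isClosed p.closed hX hY]
  simp

/-- With `X` the vector component of `α`, the section `J(i_X ω)` has the same vector component, so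
the difference is a covector field `ζ = i_Z ω`. -/
lemma exists_eq_add (hα : SmoothSectionAt α x₀) : ∃ Z X : Π x : M, TangentSpace 𝓘(ℝ, E) x,
    SmoothSectionAt (vecSection Z) x₀ ∧ SmoothSectionAt (vecSection X) x₀ ∧
      α = fun x ↦ covSection (fun x ↦ p.omega.toFun x (Z x)) x +
        p.genEnd x (covSection (fun x ↦ p.omega.toFun x (X x)) x) := by
  have hX := hα.vecSection_fst
  have hJX := (hX.contract p.omega).apply (p.contMDiffAt_genEndCoord x₀)
  have hζ := (hα.add hJX.neg).covSection_snd
  -- The field `Z = π♯ ζ` is taken as the vector component of `J(0, ζ)`, so that its smoothness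
  -- follows from that of `J`.
  have hZ := (hζ.apply (p.contMDiffAt_genEndCoord x₀)).vecSection_fst
  refine ⟨_, _, hZ, hX, funext fun x ↦ ?_⟩
  have h0 : ∀ ζ : CotangentSpace E x,
      p.omega.toFun x (p.genEnd x ((0, ζ) : GenTangentSpace E x)).1 = ζ := fun ζ ↦ by
    rw [genEnd_inr, p.omega_bivector]
  have h1 : (p.genEnd x (covSection (fun x ↦ p.omega.toFun x (α x).1) x)).1 = (α x).1 := by
    rw [covSection, genEnd_inr, p.bivector_omega]
  refine Prod.ext ?_ ?_
  · rw [Prod.fst_add, h1]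
    simp [covSection]
  · simp only [covSection, h0, Prod.snd_add, Prod.snd_neg]
    simp

lemma torsion_eq_zero (hα : SmoothSectionAt α x₀) (hβ : SmoothSectionAt β x₀) :
    torsion p.genEnd α β x₀ = 0 := by
  have hJ : ∀ {γ : Π x : M, GenTangentSpace E x}, SmoothSectionAt γ x₀ →
      SmoothSectionAt (fun x ↦ p.genEnd x (γ x)) x₀ :=
    fun h ↦ h.apply (p.contMDiffAt_genEndCoord x₀)
  -- Reduces the second argument to covector fields. Using it once in each slot, with antisymmetry
  -- in between, leaves only the torsion of two covector fields.
  have key : ∀ {α β : Π x : M, GenTangentSpace E x}, SmoothSectionAt α x₀ → SmoothSectionAt β x₀ →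
      (∀ X : Π x : M, TangentSpace 𝓘(ℝ, E) x, SmoothSectionAt (vecSection X) x₀ →
        torsion p.genEnd α (covSection fun x ↦ p.omega.toFun x (X x)) x₀ = 0) →
      torsion p.genEnd α β x₀ = 0 := by
    intro α β hα hβ h
    obtain ⟨Z, X, hZ, hX, rfl⟩ := p.exists_eq_add hβ
    have hZ' := hZ.contract p.omega
    have hX' := hX.contract p.omega
    rw [torsion_add_right hα hZ' (hJ hX') (hJ hα) (hJ hZ') (hJ (hJ hX')),
      torsion_apply_right p.genEnd_genEnd hα hX' (hJ hα), h Z hZ, h X hX]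
    simp
  refine key hα hβ fun X hX ↦ ?_
  have hX' := hX.contract p.omega
  rw [torsion_swap hX' hα (hJ hX') (hJ hα), key hX' hα fun Y hY ↦ p.torsion_omega_eq_zero hX hY,
    neg_zero]

/-- The generalized complex structure of a Hitchin pair. -/
def genComplexStructure : GenComplexStructure E M where
  toFun := p.genEnd
  smooth x₀ := contMDiffAt_genEnd_iff.2 (p.contMDiffAt_genEndCoord x₀)
  sq_eq_neg := p.genEnd_genEnd
  torsion_free _ _ hα hβ x := p.torsion_eq_zero (isSmoothSection_iff.1 hα x)
    (isSmoothSection_iff.1 hβ x)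

lemma piSharp_genComplexStructure (x : M) (ξ : CotangentSpace E x) :
    p.genComplexStructure.piSharp x ξ = p.bivector x ξ :=
  congrArg Prod.fst (p.genEnd_inr x ξ)

lemma isNondegenerate_genComplexStructure : p.genComplexStructure.IsNondegenerate := by
  intro x
  refine ⟨fun ξ η h ↦ ?_, fun v ↦ ⟨p.omega.toFun x v, ?_⟩⟩
  · rw [piSharp_genComplexStructure, piSharp_genComplexStructure] at h
    rw [← p.omega_bivector x ξ, h, p.omega_bivector]
  · rw [piSharp_genComplexStructure, p.bivector_omega]

end HitchinPair

/-! ### The two constructions are mutually inverse. -/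

section Correspondence

variable [FiniteDimensional ℝ E] [T2Space M]

lemma HitchinPair.hitchinPair_genComplexStructure (p : HitchinPair E M) :
    p.isNondegenerate_genComplexStructure.hitchinPair = p := by
  refine HitchinPair.ext (TwoForm.ext (funext fun x ↦ ContinuousLinearMap.ext fun v ↦ ?_))
    (EndField.ext (funext fun x ↦ ContinuousLinearMap.ext fun v ↦ ?_))
  · have h := p.isNondegenerate_genComplexStructure.form_piSharp x (p.omega.toFun x v)
    rwa [p.piSharp_genComplexStructure, p.bivector_omega] at h
  · refine (congrArg Prod.fst (p.genEnd_apply x v 0)).trans ?_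
    simp

lemma GenComplexStructure.IsNondegenerate.genComplexStructure_hitchinPair
    {J : GenComplexStructure E M} (hJ : J.IsNondegenerate) :
    hJ.hitchinPair.genComplexStructure = J := by
  refine GenComplexStructure.ext (funext fun x ↦ ContinuousLinearMap.ext fun w ↦ ?_)
  obtain ⟨v, ξ⟩ := w
  refine (hJ.hitchinPair.genEnd_apply x v ξ).trans ((hJ.apply_eq x v ξ).trans ?_).symm
  have h : J.piSharp x ξ = hJ.hitchinPair.bivector x ξ := by
    rw [← hJ.hitchinPair.bivector_omega x (J.piSharp x ξ)]
    exact congrArg _ (hJ.form_piSharp x ξ)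
  rw [h]

variable (E M) in
/-- The correspondence between non-degenerate generalized complex structures and Hitchin pairs. -/
def hitchinEquiv : {J : GenComplexStructure E M // J.IsNondegenerate} ≃ HitchinPair E M where
  toFun J := J.2.hitchinPair
  invFun p := ⟨p.genComplexStructure, p.isNondegenerate_genComplexStructure⟩
  left_inv J := Subtype.ext J.2.genComplexStructure_hitchinPair
  right_inv p := p.hitchinPair_genComplexStructure

end Correspondence

end FromHitchinPair

end GenComplex

end

theorem mainTheorem5 {E : Type*} [NormedAddCommGroup E] [NormedSpace ℝ E] [FiniteDimensional ℝ E]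
    {M : Type*} [TopologicalSpace M] [T2Space M] [ChartedSpace E M] [IsManifold 𝓘(ℝ, E) ∞ M] :
    ∃ Φ : {J : GenComplex.GenComplexStructure E M // J.IsNondegenerate} ≃
        GenComplex.HitchinPair E M,
      ∀ (J : {J : GenComplex.GenComplexStructure E M // J.IsNondegenerate}) (x : M),
        -- `π` is a bivector, and it is the inverse of `ω`
        (∀ ξ : GenComplex.CotangentSpace E x, ξ (J.1.piSharp x ξ) = 0) ∧
        (∀ X, J.1.piSharp x ((Φ J).omega.toFun x X) = X) ∧
        (∀ ξ, (Φ J).omega.toFun x (J.1.piSharp x ξ) = ξ) ∧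
        -- `J` has components `a`, `π♯`, `σ_♯` and `-a*`, where `σ` is the twist of `(ω, a)`
        ∀ (X : TangentSpace 𝓘(ℝ, E) x) (ξ : GenComplex.CotangentSpace E x),
          J.1.toFun x (X, ξ) =
            ((Φ J).a.toFun x X + J.1.piSharp x ξ,
              (Φ J).twist.toFun x X - ξ.comp ((Φ J).a.toFun x)) := by
  refine ⟨GenComplex.hitchinEquiv E M, fun J x ↦ ⟨fun ξ ↦ ?_, J.2.piSharp_form x,
    J.2.form_piSharp x, J.2.apply_eq x⟩⟩
  have h := J.2.piSharp_skew x ξ ξ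
  linarith
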